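/- Notation. $B_r(x)\subset\mathbb R^m$ is the open ball, $|\cdot|$ is Lebesgue measure on $\mathbb R^m$, $\mathrm{Vol}^m$ is the $m$-dimensional Hausdorff measure on $\mathbb R^{m+n}=\mathbb R^m\times\mathbb R^n$ (normalized to agree with Lebesgue measure on $m$-planes), $\mathrm{gr}(u,F)=\{(x,u(x)):x\in F\}$, and matrices carry the Hilbert–Schmidt norm. The space of $m$-vectors carries the Euclidean scalar product with $\langle v_1\wedge\dots\wedge v_m,w_1\wedge\dots\wedge w_m\rangle=\det(\langle v_j,w_k\rangle)$; $\vec\pi_0=e_1\wedge\dots\wedge e_m$, and for a Lipschitz map $u$ differentiable at $x$, $\vec T_{(x,u(x))}\mathrm{gr}(u)$ is the $m$-vector $(e_1+du(e_1))\wedge\dots\wedge(e_m+du(e_m))$ (differential at $x$) divided by its norm. Let $c_0>0$ and let $u:\Omega\subset\mathbb R^m\to\mathbb R^n$ be Lipschitz with $\mathrm{Lip}(u)\le 2$. The graph of $u$ is called area minimizing if the following holds for every $A\in SO(m+n)$ with $|A-\mathrm{Id}|\le c_0$: whenever $A(\mathrm{gr}(u,\Omega))=\mathrm{gr}(u',\Omega')$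 for some $\Omega'\subset\mathbb R^m$ and some Lipschitz $u':\Omega'\to\mathbb R^n$, every Lipschitz $w:\Omega'\to\mathbb R^n$ with $\{w\ne u'\}\subset\subset\Omega'$ satisfies $\mathrm{Vol}^m(\mathrm{gr}(w,\Omega'))\ge\mathrm{Vol}^m(\mathrm{gr}(u',\Omega'))$. Proposition. For all $m,n$ there are constants $\bar\varepsilon>0$ and $\gamma>0$, depending only on $m$ and $n$, with the following property. Let $c_0>0$, $r>0$, $x\in\mathbb R^m$, and let $v:B_r(x)\to\mathbb R^n$ be a Lipschitz map with $\mathrm{Lip}(v)\le 2$ whose graph is area minimizing and such that $$E:=r^{-m}\cdot\frac12\int_{\mathrm{gr}(v,B_r(x))}|\vec T_p\,\mathrm{gr}(v)-\vec\pi_0|^2\,d\mathrm{Vol}^m(p)<\bar\varepsilon .$$ Set $\rho:=r(1-E^\gamma)$. Then there is a (measurable) set $K\subset B_\rho(x)$ such that $$|B_\rho(x)\setminus K|\le r^mE^{1+\gamma}\qquad\text{and}\qquad \mathrm{Lip}(v|_K)\le E^\gamma .$$ -/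

import Mathlib

open MeasureTheory

noncomputable section

namespace AreaMinGraph

/-- `ℝᵏ` with its Euclidean norm. -/
abbrev E (k : ℕ) : Type := EuclideanSpace ℝ (Fin k)

/-- `ℝ^{m+n} = ℝᵐ × ℝⁿ` with its Euclidean norm; the first `m` coordinates are indexed by
`Sum.inl`, the last `n` by `Sum.inr`. -/
abbrev Amb (m n : ℕ) : Type := EuclideanSpace ℝ (Fin m ⊕ Fin n)

variable {m n : ℕ}

/-- The component `x` of `p = (x, y)`. -/
def base (p : Amb m n) : E m := WithLp.toLp 2 fun i => p (Sum.inl i)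

/-- The component `y` of `p = (x, y)`. -/
def fibre (p : Amb m n) : E n := WithLp.toLp 2 fun k => p (Sum.inr k)

/-- The point `(x, y)` of `ℝᵐ × ℝⁿ`. -/
def pair (x : E m) (y : E n) : Amb m n := WithLp.toLp 2 (Sum.elim x y)

/-- `gr (u, F) = {(x, y) ∈ F × ℝⁿ : y = u x}`. -/
def graph (u : E m → E n) (F : Set (E m)) : Set (Amb m n) :=
  {p | base p ∈ F ∧ fibre p = u (base p)}

/-- The Hilbert-Schmidt norm of a matrix. -/
def hsNorm {ι : Type*} [Fintype ι] (B : Matrix ι ι ℝ) : ℝ :=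
  Real.sqrt (∑ i, ∑ j, (B i j) ^ 2)

/-- The graph of `u` over `Ω` is area minimizing, where rotations of size at most `c₀` are
considered: whenever a rotation `A ∈ SO(m+n)` with `|A - Id| ≤ c₀` transforms the graph
into the graph of a Lipschitz map `u'` over a domain `Ω' ⊆ ℝᵐ`, every Lipschitz map `w` on `Ω'`
with `{w ≠ u'} ⊂⊂ Ω'` has a graph of at least the same `m`-dimensional volume.
`μHE[m]` is the `m`-dimensional Hausdorff measure, normalized to agree with Lebesgue measure
on `m`-dimensional Euclidean spaces. -/
def IsAreaMinimizing (c₀ : ℝ) (u : E m → E n) (Ω : Set (E m)) : Prop :=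
  ∀ A ∈ Matrix.specialOrthogonalGroup (Fin m ⊕ Fin n) ℝ, hsNorm (A - 1) ≤ c₀ →
    ∀ (Ω' : Set (E m)) (u' : E m → E n), (∃ L, LipschitzOnWith L u' Ω') →
      (Matrix.toEuclideanLin A) '' graph u Ω = graph u' Ω' →
      ∀ w : E m → E n, (∃ L, LipschitzOnWith L w Ω') →
        IsCompact (closure {x ∈ Ω' | w x ≠ u' x}) → closure {x ∈ Ω' | w x ≠ u' x} ⊆ Ω' →
        μHE[m] (graph u' Ω') ≤ μHE[m] (graph w Ω')

/-- The standard unit `m`-vector `e₁ ∧ ⋯ ∧ e_m` orienting `ℝᵐ × {0}`. The norm on the space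
`⋀[ℝ]^m (Amb m n)` of `m`-vectors is the one induced by the scalar product with
`⟨v₁ ∧ ⋯ ∧ v_m, w₁ ∧ ⋯ ∧ w_m⟩ = det ⟨v_j, w_k⟩`. -/
def piZero (m n : ℕ) : ⋀[ℝ]^m (Amb m n) :=
  exteriorPower.ιMulti ℝ m fun j => pair (EuclideanSpace.single j 1) 0

/-- The `m`-vector `(e₁ + du(e₁)) ∧ ⋯ ∧ (e_m + du(e_m))` for the differential `du` at `x`. -/
def rawTangent (u : E m → E n) (x : E m) : ⋀[ℝ]^m (Amb m n) :=
  exteriorPower.ιMulti ℝ m fun j =>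
    pair (EuclideanSpace.single j 1) (fderiv ℝ u x (EuclideanSpace.single j 1))

/-- The unit `m`-vector orienting the tangent space of the graph of `u` at `(x, u x)`. -/
def tangent (u : E m → E n) (x : E m) : ⋀[ℝ]^m (Amb m n) :=
  ‖rawTangent u x‖⁻¹ • rawTangent u x

/-- The cylindrical excess of the graph of `u` in the cylinder `B_r(x) × ℝⁿ` with respect to the
plane oriented by the unit `m`-vector `π`. -/
def cylExcess (u : E m → E n) (x : E m) (r : ℝ) (π : ⋀[ℝ]^m (Amb m n)) : ℝ :=
  (1 / 2) * ∫ p in graph u (Metric.ball x r), ‖tangent u (base p) - π‖ ^ 2 ∂μHE[m]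

/-- The cylindrical excess with respect to `ℝᵐ × {0}`, normalized by the factor `r⁻ᵐ`. -/
def normExcess (u : E m → E n) (x : E m) (r : ℝ) : ℝ :=
  (r ^ m)⁻¹ * cylExcess u x r (piZero m n)

end AreaMinGraph

end

open MeasureTheory

noncomputable section

namespace AreaMinGraph

open Set Module Metric
open scoped NNReal ENNReal RealInnerProductSpace

/-! ### Area formula for expanding Lipschitz maps -/

section AreaFormula

set_option linter.unusedSectionVars false

variable {U V : Type*} [NormedAddCommGroup U] [InnerProductSpace ℝ U] [FiniteDimensional ℝ U]
  [MeasurableSpace U] [BorelSpace U]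
  [NormedAddCommGroup V] [InnerProductSpace ℝ V] [FiniteDimensional ℝ V]
  [MeasurableSpace V] [BorelSpace V]

/-! Write `J` for the area density of a graph and `hs` for the squared Hilbert–Schmidt norm. By the
area formula and `J_mul_excess_density`, the excess is the integral of `J (Du) - 1`, which for a
Lipschitz map is comparable to the Dirichlet energy. After rescaling to the unit ball put `M = 32 *
(m + 1)`, `γ = 1 / M` and `q = E ^ γ`, so that `E = q ^ M`.

The heart is a gain of integrability: the steep points, where `hs (Du) > κ`, carry far less energy
than `E`. Compare `u` with the map that equals its average over `δ`-balls inside a ball of radius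
`s` and is interpolated back to `u` in a thin layer. Where `hs (Du) ≤ κ`, area minus one and half
the energy agree up to a small relative error, and averaging does not increase energy. The steep
part of the gradient, however, is bounded in `L¹` by `κ ^ (-1/2)` times the energy; its average is
therefore pointwise small, and the square of that average is quadratic in the energy. Averaging thus
nearly erases the area excess of the steep points, so by minimality this excess is bounded by the
errors: `exists_energy_lowSet_compl_le`. One error is the energy in an annulus around the layer,
made small by pigeonhole over many annuli (`exists_annulus_setIntegral_le`). With `κ = q ^ 8` the
steep energy is at most a constant times `q ^ (M + 8)`: `exists_scale_energy_lowSet_compl_le`.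

The weak type estimate for the maximal function of the steep gradient then removes a set of measure
at most `q ^ (M + 1)`. On the rest, small distances are handled by the maximal function and large
ones by the gradient of the averaged map: `norm_sub_le_of_maximal_le_of_fderiv_mavg_le`. Zero excess
is the separate case `eq_of_excess_eq_zero`. -/

theorem euclideanHausdorffMeasure_image_le_of_lipschitzOnWith {X Y : Type*}
    [MetricSpace X] [MeasurableSpace X] [BorelSpace X]
    [MetricSpace Y] [MeasurableSpace Y] [BorelSpace Y] {f : X → Y} {K : ℝ≥0} {s : Set X}
    (hf : LipschitzOnWith K f s) (d : ℕ) :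
    μHE[d] (f '' s) ≤ (K : ℝ≥0∞) ^ d * μHE[d] s := by
  have h := hf.hausdorffMeasure_image_le (d := (d : ℝ)) (by positivity)
  simp only [Measure.euclideanHausdorffMeasure_def, Measure.smul_apply, ENNReal.smul_def,
    smul_eq_mul]
  calc _ ≤ _ := mul_le_mul_right h _
    _ = _ := by rw [ENNReal.rpow_natCast]; ring

/-- If `f` is dominated by `h` up to the factor `K` on `s`, then the image of `s` under `f` has
at most `K ^ d` times the volume of the image under `h`. -/
theorem euclideanHausdorffMeasure_image_le_of_norm_sub_le {X : Type*} {f h : X → V} {K : ℝ≥0}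
    {s : Set X} (H : ∀ x ∈ s, ∀ y ∈ s, ‖f x - f y‖ ≤ K * ‖h x - h y‖) (d : ℕ) :
    μHE[d] (f '' s) ≤ (K : ℝ≥0∞) ^ d * μHE[d] (h '' s) := by
  rcases s.eq_empty_or_nonempty with rfl | ⟨x₀, hx₀⟩
  · simp
  have : Nonempty X := ⟨x₀⟩
  -- This is `f ∘ h⁻¹` on `h '' s`: points of `s` with equal `h` have equal `f`, so the chosen
  -- preimage is immaterial.
  set k : V → V := fun p => f (Function.invFunOn h s p) with hk
  have key : ∀ x ∈ s, k (h x) = f x := by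
    intro x hx
    have h1 := Function.invFunOn_mem (f := h) (s := s) ⟨x, hx, rfl⟩
    have h2 := Function.invFunOn_eq (f := h) (s := s) ⟨x, hx, rfl⟩
    have := H _ h1 x hx
    rw [h2, sub_self, norm_zero, mul_zero] at this
    exact sub_eq_zero.1 (norm_le_zero_iff.1 this)
  have hL : LipschitzOnWith K k (h '' s) := by
    apply LipschitzOnWith.of_dist_le_mul
    rintro _ ⟨x, hx, rfl⟩ _ ⟨y, hy, rfl⟩
    rw [key x hx, key y hy, dist_eq_norm, dist_eq_norm]
    exact H x hx y hy
  have : f '' s = k '' (h '' s) := by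
    rw [image_image]
    exact image_congr fun x hx => (key x hx).symm
  rw [this]
  exact euclideanHausdorffMeasure_image_le_of_lipschitzOnWith hL d

/-- The Jacobian of a linear map, as an extended nonnegative number. -/
def jac (A : U →L[ℝ] V) : ℝ≥0∞ := ENNReal.ofReal (LinearMap.normDet (A : U →ₗ[ℝ] V))

theorem euclideanHausdorffMeasure_image_clm (A : U →L[ℝ] V) (s : Set U) :
    μHE[finrank ℝ U] (A '' s) = jac A * volume s :=
  (A : U →ₗ[ℝ] V).euclideanHausdorffMeasure_image_eq_normDet_mul_volume s

/-- Comparing the volumes of the images of the unit ball replaces any manipulation of determinants.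
-/
theorem jac_le_of_norm_le {A B : U →L[ℝ] V} {K : ℝ≥0} (H : ∀ h, ‖A h‖ ≤ K * ‖B h‖) :
    jac A ≤ (K : ℝ≥0∞) ^ finrank ℝ U * jac B := by
  have h1 := euclideanHausdorffMeasure_image_le_of_norm_sub_le (f := A) (h := B) (K := K)
    (s := Metric.ball (0 : U) 1) (fun x _ y _ => by simpa using H (x - y)) (finrank ℝ U)
  rw [euclideanHausdorffMeasure_image_clm, euclideanHausdorffMeasure_image_clm, ← mul_assoc] at h1
  have h0 : volume (Metric.ball (0 : U) 1) ≠ 0 :=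
    (Metric.measure_ball_pos volume (0 : U) one_pos).ne'
  have h2 : volume (Metric.ball (0 : U) 1) ≠ ∞ := measure_ball_lt_top.ne
  exact (ENNReal.mul_le_mul_iff_left h0 h2).1 h1

theorem measure_le_of_pairwise_disjoint_cover {X : Type*} [MeasurableSpace X] {μ ν : Measure X}
    {t : ℕ → Set X} (hd : Pairwise (Function.onFun Disjoint t)) (ht : ∀ n, MeasurableSet (t n))
    {S : Set X} (hS : MeasurableSet S) (hc : S ⊆ ⋃ n, t n) (H : ∀ n, μ (S ∩ t n) ≤ ν (S ∩ t n)) :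
    μ S ≤ ν S := by
  have e : S = ⋃ n, S ∩ t n := by rw [← inter_iUnion, inter_eq_left.2 hc]
  have hd' : Pairwise (Function.onFun Disjoint fun n => S ∩ t n) := fun i j hij =>
    (hd hij).mono inter_subset_right inter_subset_right
  rw [e, measure_iUnion hd' fun n => hS.inter (ht n), measure_iUnion hd' fun n => hS.inter (ht n)]
  exact ENNReal.tsum_le_tsum H

theorem measurable_jac_fderiv (f : U → V) : Measurable fun x => jac (fderiv ℝ f x) := by
  have hc : Continuous fun A : U →L[ℝ] V => LinearMap.normDet (A : U →ₗ[ℝ] V) := by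
    have : (fun A : U →L[ℝ] V => LinearMap.normDet (A : U →ₗ[ℝ] V)) = fun A : U →L[ℝ] V =>
        Real.sqrt (Matrix.gram ℝ fun i => A (stdOrthonormalBasis ℝ U i)).det := by
      funext A
      have := (A : U →ₗ[ℝ] V).normDet_sq_eq_det_gram (stdOrthonormalBasis ℝ U)
      simp only [RCLike.ofReal_real_eq_id, id, ContinuousLinearMap.coe_coe] at this
      rw [← this, Real.sqrt_sq (LinearMap.normDet_nonneg _)]
    rw [this]
    refine Real.continuous_sqrt.comp (Continuous.matrix_det ?_)
    refine continuous_matrix fun i j => ?_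
    simp only [Matrix.gram_apply]
    fun_prop
  exact ENNReal.measurable_ofReal.comp (hc.measurable.comp (measurable_fderiv ℝ f))

variable {f : U → V} {C : ℝ≥0}

/-- Because `f`, its derivatives and `A` do not shrink lengths, every additive error `δ * ‖h‖` is
absorbed into a factor `1 + δ`. Passing from `f` to `A` costs one power `d` of it, passing from `A`
to the derivatives another. -/
theorem area_pieces {δ : ℝ≥0} (hδ : 0 < δ) (hf1 : ∀ x y, ‖x - y‖ ≤ ‖f x - f y‖)
    (hf' : ∀ x, DifferentiableAt ℝ f x → ∀ h, ‖h‖ ≤ ‖fderiv ℝ f x h‖)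
    {P : Set U} (hP : ∀ x ∈ P, DifferentiableAt ℝ f x) {A : U →L[ℝ] V}
    (hA : ApproximatesLinearOn f A P δ) (hA1 : ∀ h, ‖h‖ ≤ ‖A h‖)
    (hAP : ∀ x ∈ P, ‖fderiv ℝ f x - A‖ ≤ δ) {S : Set U} (hS : MeasurableSet S) (hSP : S ⊆ P) :
    μHE[finrank ℝ U] (f '' S) ≤ ((1 + δ : ℝ≥0) : ℝ≥0∞) ^ (2 * finrank ℝ U) *
        ∫⁻ x in S, jac (fderiv ℝ f x) ∧
    ∫⁻ x in S, jac (fderiv ℝ f x) ≤ ((1 + δ : ℝ≥0) : ℝ≥0∞) ^ (2 * finrank ℝ U) *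
      μHE[finrank ℝ U] (f '' S) := by
  set d := finrank ℝ U
  set K : ℝ≥0 := 1 + δ with hK
  have hKr : (K : ℝ) = 1 + δ := by simp [hK]
  have j1 : ∀ x ∈ P, jac A ≤ (K : ℝ≥0∞) ^ d * jac (fderiv ℝ f x) := fun x hx => by
    refine jac_le_of_norm_le fun h => ?_
    have h1 := (fderiv ℝ f x - A).le_opNorm h
    have h2 := hf' x (hP x hx) h
    have h3 : ‖A h‖ ≤ ‖fderiv ℝ f x h‖ + ‖(fderiv ℝ f x - A) h‖ := by
      have : A h = fderiv ℝ f x h - (fderiv ℝ f x - A) h := by simp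
      rw [this]; exact norm_sub_le _ _
    have h4 : ‖fderiv ℝ f x - A‖ * ‖h‖ ≤ δ * ‖fderiv ℝ f x h‖ := by
      gcongr; exact hAP x hx
    rw [hKr]; linarith
  have j2 : ∀ x ∈ P, jac (fderiv ℝ f x) ≤ (K : ℝ≥0∞) ^ d * jac A := fun x hx => by
    refine jac_le_of_norm_le fun h => ?_
    have h1 := (fderiv ℝ f x - A).le_opNorm h
    have h2 := hA1 h
    have h3 : ‖fderiv ℝ f x h‖ ≤ ‖A h‖ + ‖(fderiv ℝ f x - A) h‖ := by
      have : fderiv ℝ f x h = A h + (fderiv ℝ f x - A) h := by simp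
      rw [this]; exact norm_add_le _ _
    have h4 : ‖fderiv ℝ f x - A‖ * ‖h‖ ≤ δ * ‖A h‖ := by
      gcongr; exact hAP x hx
    rw [hKr]; linarith
  have i1 : μHE[d] (f '' S) ≤ (K : ℝ≥0∞) ^ d * (jac A * volume S) := by
    rw [← euclideanHausdorffMeasure_image_clm]
    refine euclideanHausdorffMeasure_image_le_of_norm_sub_le (fun x hx y hy => ?_) d
    have h1 := hA x (hSP hx) y (hSP hy)
    have h2 := hA1 (x - y)
    rw [map_sub] at h1 h2
    have h3 : ‖f x - f y‖ ≤ ‖A x - A y‖ + ‖f x - f y - (A x - A y)‖ := by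
      conv_lhs => rw [← add_sub_cancel (A x - A y) (f x - f y)]
      exact norm_add_le _ _
    have h4 : (δ : ℝ) * ‖x - y‖ ≤ δ * ‖A x - A y‖ := by gcongr
    rw [hKr]; linarith
  have i2 : jac A * volume S ≤ (K : ℝ≥0∞) ^ d * μHE[d] (f '' S) := by
    rw [← euclideanHausdorffMeasure_image_clm]
    refine euclideanHausdorffMeasure_image_le_of_norm_sub_le (fun x hx y hy => ?_) d
    have h1 := hA x (hSP hx) y (hSP hy)
    have h2 := hf1 x y
    rw [map_sub] at h1
    have h3 : ‖A x - A y‖ ≤ ‖f x - f y‖ + ‖f x - f y - (A x - A y)‖ := by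
      have : A x - A y = (f x - f y) - (f x - f y - (A x - A y)) := by abel
      conv_lhs => rw [this]
      exact norm_sub_le _ _
    have h4 : (δ : ℝ) * ‖x - y‖ ≤ δ * ‖f x - f y‖ := by gcongr
    rw [hKr]; linarith
  rw [two_mul, pow_add, mul_assoc, mul_assoc]
  constructor
  · refine i1.trans (mul_le_mul_right ?_ _)
    rw [← lintegral_const_mul _ (measurable_jac_fderiv f), ← setLIntegral_const]
    exact setLIntegral_mono' hS fun x hx => j1 x (hSP hx)
  · calc ∫⁻ x in S, jac (fderiv ℝ f x) ≤ ∫⁻ x in S, (K : ℝ≥0∞) ^ d * jac A :=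
          setLIntegral_mono' hS fun x hx => j2 x (hSP hx)
      _ = (K : ℝ≥0∞) ^ d * (jac A * volume S) := by rw [setLIntegral_const, mul_assoc]
      _ ≤ _ := mul_le_mul_right i2 _

/-- The area formula for an expanding Lipschitz map. -/
theorem euclideanHausdorffMeasure_image_eq_lintegral_jac (hf : LipschitzWith C f)
    (hf1 : ∀ x y, ‖x - y‖ ≤ ‖f x - f y‖)
    (hf' : ∀ x, DifferentiableAt ℝ f x → ∀ h, ‖h‖ ≤ ‖fderiv ℝ f x h‖)
    {S : Set U} (hS : MeasurableSet S) :
    μHE[finrank ℝ U] (f '' S) = ∫⁻ x in S, jac (fderiv ℝ f x) := by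
  set d := finrank ℝ U with hd
  -- An expanding map is a closed embedding, so the Hausdorff measure pulls back to a measure on
  -- `U`, which is then compared with the density `jac`.
  have hemb : MeasurableEmbedding f := by
    have hanti : AntilipschitzWith 1 f :=
      AntilipschitzWith.of_le_mul_dist fun x y => by simpa [dist_eq_norm] using hf1 x y
    exact (hanti.isClosedEmbedding hf.uniformContinuous).measurableEmbedding
  set ν : Measure U := Measure.comap f μHE[d] with hν
  have hνS : ∀ S, ν S = μHE[d] (f '' S) := fun S => hemb.comap_apply _ S
  set μJ : Measure U := volume.withDensity fun x => jac (fderiv ℝ f x) with hμJ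
  have hμS : ∀ S, MeasurableSet S → μJ S = ∫⁻ x in S, jac (fderiv ℝ f x) := fun S hS =>
    withDensity_apply _ hS
  set D : Set U := {x | DifferentiableAt ℝ f x} with hD
  have hDm : MeasurableSet D := measurableSet_of_differentiableAt ℝ f
  have hD0 : volume Dᶜ = 0 := by
    have := hf.ae_differentiableAt (μ := (volume : Measure U))
    exact this
  have hνac : ∀ T, volume T = 0 → ν T = 0 := fun T hT => by
    rw [hνS]
    have h := euclideanHausdorffMeasure_image_le_of_lipschitzOnWith (hf.lipschitzOnWith (s := T)) d
    rw [InnerProductSpace.euclideanHausdorffMeasure_eq_volume, hT, mul_zero] at h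
    exact nonpos_iff_eq_zero.1 h
  have hμac : ∀ T, volume T = 0 → μJ T = 0 := fun T hT =>
    withDensity_absolutelyContinuous _ _ hT
  -- comparison up to a constant close to one
  have main : ∀ δ : ℝ≥0, 0 < δ → ∀ S, MeasurableSet S → S ⊆ D →
      ν S ≤ ((1 + δ : ℝ≥0) : ℝ≥0∞) ^ (2 * d) * μJ S ∧
      μJ S ≤ ((1 + δ : ℝ≥0) : ℝ≥0∞) ^ (2 * d) * ν S := by
    intro δ hδ S hS hSD
    obtain ⟨B, hB⟩ := TopologicalSpace.exists_dense_seq (U →L[ℝ] V)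
    -- The radius `δ / 2` makes any two derivatives in one piece differ by less than `δ`; the linear
    -- map attached to a cell of the partition is itself the derivative at a point of the piece.
    set s : ℕ → Set U := fun k => D ∩ {x | ‖fderiv ℝ f x - B k‖ < δ / 2} with hs
    have hsm : ∀ k, MeasurableSet (s k) := fun k => by
      refine hDm.inter (measurableSet_lt ?_ measurable_const)
      exact ((measurable_fderiv ℝ f).sub measurable_const).norm
    have hsc : D ⊆ ⋃ k, s k := fun x hx => by
      obtain ⟨k, hk⟩ := hB.exists_dist_lt (fderiv ℝ f x) (half_pos (NNReal.coe_pos.2 hδ))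
      exact mem_iUnion.2 ⟨k, hx, by simpa [dist_eq_norm] using hk⟩
    have piece : ∀ T, MeasurableSet T → ∀ k, T ⊆ s k →
        ν T ≤ ((1 + δ : ℝ≥0) : ℝ≥0∞) ^ (2 * d) * μJ T ∧
        μJ T ≤ ((1 + δ : ℝ≥0) : ℝ≥0∞) ^ (2 * d) * ν T := by
      intro T hT k hTk
      rcases (s k).eq_empty_or_nonempty with he | hne
      · rw [he, subset_empty_iff] at hTk; subst hTk; simp
      obtain ⟨t, A, td, tm, tc, hA, hAy⟩ :=
        exists_partition_approximatesLinearOn_of_hasFDerivWithinAt f (s k) (fderiv ℝ f)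
          (fun x hx => (DifferentiableAt.hasFDerivAt hx.1).hasFDerivWithinAt)
          (fun _ => δ) fun _ => hδ.ne'
      have loc : ∀ n, ν (T ∩ t n) ≤ ((1 + δ : ℝ≥0) : ℝ≥0∞) ^ (2 * d) * μJ (T ∩ t n) ∧
          μJ (T ∩ t n) ≤ ((1 + δ : ℝ≥0) : ℝ≥0∞) ^ (2 * d) * ν (T ∩ t n) := by
        intro n
        obtain ⟨y, hy, hAn⟩ := hAy hne n
        rw [hνS, hμS _ (hT.inter (tm n))]
        refine area_pieces hδ hf1 hf' (P := s k ∩ t n) (fun x hx => hx.1.1) (hA n)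
          (hAn ▸ hf' y hy.1) (fun x hx => ?_) (hT.inter (tm n)) (inter_subset_inter_left _ hTk)
        rw [hAn]
        have h1 := hx.1.2
        have h2 := hy.2
        simp only [mem_ofPred_eq] at h1 h2
        have h3 : fderiv ℝ f x - fderiv ℝ f y
          = (fderiv ℝ f x - B k) - (fderiv ℝ f y - B k) := by abel
        have h4 := norm_sub_le (fderiv ℝ f x - B k) (fderiv ℝ f y - B k)
        rw [h3]; linarith
      constructor
      · exact measure_le_of_pairwise_disjoint_cover (ν := ((1 + δ : ℝ≥0) : ℝ≥0∞) ^ (2 * d) • μJ)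
          td tm hT (hTk.trans tc) fun n => by simpa using (loc n).1
      · exact measure_le_of_pairwise_disjoint_cover (ν := ((1 + δ : ℝ≥0) : ℝ≥0∞) ^ (2 * d) • ν)
          td tm hT (hTk.trans tc) fun n => by simpa using (loc n).2
    have hcov : S ⊆ ⋃ k, disjointed s k := by rw [iUnion_disjointed]; exact hSD.trans hsc
    have loc := fun k => piece (S ∩ disjointed s k) (hS.inter (.disjointed hsm k)) k
      (inter_subset_right.trans (disjointed_subset s k))
    constructor
    · exact measure_le_of_pairwise_disjoint_cover (ν := ((1 + δ : ℝ≥0) : ℝ≥0∞) ^ (2 * d) • μJ)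
        (disjoint_disjointed s) (fun n => .disjointed hsm n) hS hcov
        fun n => by simpa using (loc n).1
    · exact measure_le_of_pairwise_disjoint_cover (ν := ((1 + δ : ℝ≥0) : ℝ≥0∞) ^ (2 * d) • ν)
        (disjoint_disjointed s) (fun n => .disjointed hsm n) hS hcov
        fun n => by simpa using (loc n).2
  have lim : ∀ a b : ℝ≥0∞,
      (∀ δ : ℝ≥0, 0 < δ → a ≤ ((1 + δ : ℝ≥0) : ℝ≥0∞) ^ (2 * d) * b) → a ≤ b := by
    intro a b h
    have ht : Filter.Tendsto (fun δ : ℝ≥0 => ((1 + δ : ℝ≥0) : ℝ≥0∞) ^ (2 * d) * b)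
        (nhdsWithin 0 (Ioi 0)) (nhds (((1 + 0 : ℝ≥0) : ℝ≥0∞) ^ (2 * d) * b)) := by
      refine ENNReal.Tendsto.mul_const ?_ (Or.inl (by simp))
      have hc : Continuous fun δ : ℝ≥0 => ((1 + δ : ℝ≥0) : ℝ≥0∞) ^ (2 * d) :=
        (ENNReal.continuous_pow _).comp
          (ENNReal.continuous_coe.comp (continuous_const.add continuous_id))
      exact hc.continuousWithinAt.tendsto
    simp only [add_zero, ENNReal.coe_one, one_pow, one_mul] at ht
    exact ge_of_tendsto ht (by filter_upwards [self_mem_nhdsWithin] with δ hδ using h δ hδ)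
  have eqD : ν (S ∩ D) = μJ (S ∩ D) := by
    have hSD := hS.inter hDm
    exact le_antisymm (lim _ _ fun δ hδ => (main δ hδ _ hSD inter_subset_right).1)
      (lim _ _ fun δ hδ => (main δ hδ _ hSD inter_subset_right).2)
  have hSd : volume (S \ D) = 0 := measure_mono_null (sdiff_subset_compl S D) hD0
  rw [← hνS, ← hμS S hS, ← measure_inter_add_sdiff S hDm, ← measure_inter_add_sdiff (μ := μJ) S hDm,
    eqD, hνac _ hSd, hμac _ hSd]

end AreaFormula

/-! ### Area density and tangent vector of a graph -/

section GraphAlgebra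

variable {m n : ℕ}

@[simp] theorem base_pair (x : E m) (y : E n) : base (pair x y) = x := by
  ext i; simp [base, pair]

@[simp] theorem fibre_pair (x : E m) (y : E n) : fibre (pair x y) = y := by
  ext i; simp [fibre, pair]

theorem pair_base_fibre (p : Amb m n) : pair (base p) (fibre p) = p := by
  ext i; cases i <;> simp [base, fibre, pair]

theorem inner_pair (x x' : E m) (y y' : E n) :
    ⟪pair x y, pair x' y'⟫ = ⟪x, x'⟫ + ⟪y, y'⟫ := by
  simp [pair, PiLp.inner_apply]

theorem norm_pair_sq (x : E m) (y : E n) : ‖pair x y‖ ^ 2 = ‖x‖ ^ 2 + ‖y‖ ^ 2 := by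
  rw [← real_inner_self_eq_norm_sq, inner_pair, real_inner_self_eq_norm_sq,
    real_inner_self_eq_norm_sq]

theorem norm_le_norm_pair (x : E m) (y : E n) : ‖x‖ ≤ ‖pair x y‖ := by
  refine (sq_le_sq₀ (norm_nonneg _) (norm_nonneg _)).1 ?_
  rw [norm_pair_sq]; nlinarith [sq_nonneg ‖y‖]

/-- The linear map `(x, y) ↦ (x, y)` from `ℝᵐ × ℝⁿ` to `ℝ^{m+n}`. -/
def pairL (m n : ℕ) : (E m × E n) →L[ℝ] Amb m n :=
  LinearMap.toContinuousLinearMap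
    { toFun := fun p => pair p.1 p.2
      map_add' := fun p q => by ext i; cases i <;> simp [pair]
      map_smul' := fun c p => by ext i; cases i <;> simp [pair] }

@[simp] theorem pairL_apply (p : E m × E n) : pairL m n p = pair p.1 p.2 := rfl

theorem pair_sub_pair (x x' : E m) (y y' : E n) :
    pair x y - pair x' y' = pair (x - x') (y - y') :=
  ((pairL m n).map_sub (x, y) (x', y')).symm

/-- The graph map `x ↦ (x, u x)`. -/
def lift (u : E m → E n) (x : E m) : Amb m n := pair x (u x)

/-- The linear graph map `h ↦ (h, A h)`. -/
def graphL (A : E m →L[ℝ] E n) : E m →L[ℝ] Amb m n :=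
  (pairL m n).comp ((ContinuousLinearMap.id ℝ (E m)).prod A)

@[simp] theorem graphL_apply (A : E m →L[ℝ] E n) (h : E m) : graphL A h = pair h (A h) := rfl

theorem graph_eq_image (u : E m → E n) (F : Set (E m)) : graph u F = lift u '' F := by
  ext p
  constructor
  · rintro ⟨h1, h2⟩
    exact ⟨base p, h1, by rw [lift, ← h2, pair_base_fibre]⟩
  · rintro ⟨x, hx, rfl⟩
    simp [graph, lift, hx]

/-- The area density `√det(Id + Aᵀ A)` of the graph of a linear map. -/
def J (A : E m →L[ℝ] E n) : ℝ := LinearMap.normDet (graphL A : E m →ₗ[ℝ] Amb m n)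

/-- The square of the Hilbert-Schmidt norm. -/
def hs (A : E m →L[ℝ] E n) : ℝ := ∑ i, ‖A (EuclideanSpace.single i 1)‖ ^ 2

theorem hs_nonneg (A : E m →L[ℝ] E n) : 0 ≤ hs A := Finset.sum_nonneg fun _ _ => by positivity

theorem J_nonneg (A : E m →L[ℝ] E n) : 0 ≤ J A := LinearMap.normDet_nonneg _

theorem J_sq_eq_det (A : E m →L[ℝ] E n) :
    J A ^ 2 = (Matrix.gram ℝ fun i => pair (EuclideanSpace.single i 1)
      (A (EuclideanSpace.single i (1 : ℝ)))).det := by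
  have := (graphL A : E m →ₗ[ℝ] Amb m n).normDet_sq_eq_det_gram (EuclideanSpace.basisFun (Fin m) ℝ)
  simpa [J] using this

theorem gram_graph (A : E m →L[ℝ] E n) :
    (Matrix.gram ℝ fun i => pair (EuclideanSpace.single i 1) (A (EuclideanSpace.single i (1 : ℝ))))
      = 1 + Matrix.gram ℝ fun i => A (EuclideanSpace.single i (1 : ℝ)) := by
  ext i j
  simp only [Matrix.gram_apply, inner_pair, Matrix.add_apply, Matrix.one_apply]
  congr 1
  simp [EuclideanSpace.inner_single_left]

/-- The determinant is the product of `1 + λ i` over the nonnegative eigenvalues: expand the product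
for the lower bound, use `1 + λ ≤ exp λ` for the upper. -/
theorem _root_.Matrix.PosSemidef.det_one_add_bounds {ι : Type*} [Fintype ι] [DecidableEq ι]
    {G : Matrix ι ι ℝ} (hG : G.PosSemidef) :
    1 + G.trace ≤ (1 + G).det ∧ (1 + G).det ≤ Real.exp G.trace := by
  have hdet : (1 + G).det = ∏ i, (1 + hG.1.eigenvalues i) := by
    have h1 := hG.1.spectral_theorem
    rw [Unitary.conjStarAlgAut_apply] at h1
    set Uu : Matrix ι ι ℝ := (hG.1.eigenvectorUnitary : Matrix ι ι ℝ) with hUu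
    have hU : Uu * star Uu = 1 := Unitary.mul_star_self_of_mem (hG.1.eigenvectorUnitary).2
    set Dg : Matrix ι ι ℝ := Matrix.diagonal (RCLike.ofReal ∘ hG.1.eigenvalues)
    have h2 : 1 + G = Uu * (1 + Dg) * star Uu := by
      rw [mul_add, add_mul, mul_one, hU]; congr 1
    have h3 : (1 + Dg) = Matrix.diagonal fun i => 1 + hG.1.eigenvalues i := by
      ext i j
      by_cases hij : i = j
      · subst hij; simp [Dg]
      · simp [Dg, hij]
    rw [h2, Matrix.det_mul, Matrix.det_mul, mul_right_comm, ← Matrix.det_mul, hU, Matrix.det_one,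
      one_mul, h3, Matrix.det_diagonal]
  have htr : G.trace = ∑ i, hG.1.eigenvalues i := by
    simpa using hG.1.trace_eq_sum_eigenvalues
  rw [hdet, htr]
  have h0 : ∀ i, 0 ≤ hG.1.eigenvalues i := hG.eigenvalues_nonneg
  constructor
  · generalize (Finset.univ : Finset ι) = s
    classical
    induction s using Finset.induction_on with
    | empty => simp
    | insert a s ha ih =>
      rw [Finset.sum_insert ha, Finset.prod_insert ha]
      have hs : 0 ≤ ∑ i ∈ s, hG.1.eigenvalues i := Finset.sum_nonneg fun i _ => h0 i
      nlinarith [h0 a, mul_le_mul_of_nonneg_left ih (h0 a), mul_nonneg (h0 a) hs]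
  · rw [Real.exp_sum]
    refine Finset.prod_le_prod (fun i _ => by linarith [h0 i]) fun i _ => ?_
    linarith [Real.add_one_le_exp (hG.1.eigenvalues i)]

theorem J_sq_bounds (A : E m →L[ℝ] E n) : 1 + hs A ≤ J A ^ 2 ∧ J A ^ 2 ≤ Real.exp (hs A) := by
  have h := (Matrix.posSemidef_gram ℝ
    fun i : Fin m => A (EuclideanSpace.single i (1 : ℝ))).det_one_add_bounds
  have ht : (Matrix.gram ℝ fun i : Fin m => A (EuclideanSpace.single i (1 : ℝ))).trace = hs A := by
    simp [Matrix.trace, hs, Matrix.gram_apply]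
  rwa [ht, ← gram_graph, ← J_sq_eq_det] at h

theorem one_le_J (A : E m →L[ℝ] E n) : 1 ≤ J A := by
  have := (J_sq_bounds A).1
  nlinarith [hs_nonneg A, J_nonneg A]

theorem J_le_exp (A : E m →L[ℝ] E n) : J A ≤ Real.exp (hs A / 2) := by
  refine (sq_le_sq₀ (J_nonneg A) (Real.exp_nonneg _)).1 ?_
  rw [← Real.exp_nat_mul]
  have h2 : ((2 : ℕ) : ℝ) * (hs A / 2) = hs A := by push_cast; ring
  rw [h2]; exact (J_sq_bounds A).2

theorem norm_le_sqrt_hs (A : E m →L[ℝ] E n) : ‖A‖ ≤ Real.sqrt (hs A) := by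
  refine A.opNorm_le_bound (Real.sqrt_nonneg _) fun x => ?_
  have hx : A x = ∑ i, x i • A (EuclideanSpace.single i (1 : ℝ)) := by
    conv_lhs => rw [← (EuclideanSpace.basisFun (Fin m) ℝ).sum_repr x]
    simp [map_sum]
  rw [hx]
  calc ‖∑ i, x i • A (EuclideanSpace.single i (1 : ℝ))‖
      ≤ ∑ i, ‖x i‖ * ‖A (EuclideanSpace.single i (1 : ℝ))‖ := by
        refine (norm_sum_le _ _).trans (Finset.sum_le_sum fun i _ => (norm_smul_le _ _))
    _ ≤ Real.sqrt (∑ i, ‖x i‖ ^ 2) * Real.sqrt (hs A) :=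
        Real.sum_mul_le_sqrt_mul_sqrt _ _ _
    _ = Real.sqrt (hs A) * ‖x‖ := by rw [EuclideanSpace.norm_eq, mul_comm]

theorem norm_sq_le_hs (A : E m →L[ℝ] E n) : ‖A‖ ^ 2 ≤ hs A := by
  have := norm_le_sqrt_hs A
  calc ‖A‖ ^ 2 ≤ Real.sqrt (hs A) ^ 2 := by gcongr
    _ = hs A := Real.sq_sqrt (hs_nonneg A)

theorem hs_le_mul_norm_sq (A : E m →L[ℝ] E n) : hs A ≤ m * ‖A‖ ^ 2 := by
  calc hs A ≤ ∑ _i : Fin m, ‖A‖ ^ 2 := by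
        refine Finset.sum_le_sum fun i _ => ?_
        gcongr
        simpa using A.le_opNorm (EuclideanSpace.single i (1 : ℝ))
    _ = m * ‖A‖ ^ 2 := by simp

theorem continuous_hs : Continuous (hs : (E m →L[ℝ] E n) → ℝ) := by
  unfold hs; fun_prop

theorem continuous_J : Continuous (J : (E m →L[ℝ] E n) → ℝ) := by
  have : (J : (E m →L[ℝ] E n) → ℝ) = fun A => Real.sqrt
      (1 + Matrix.gram ℝ fun i => A (EuclideanSpace.single i (1 : ℝ))).det := by
    funext A
    rw [← gram_graph, ← J_sq_eq_det, Real.sqrt_sq (J_nonneg A)]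
  rw [this]
  refine Real.continuous_sqrt.comp (Continuous.matrix_det (continuous_const.add ?_))
  refine continuous_matrix fun i j => ?_
  simp only [Matrix.gram_apply]
  fun_prop

/-- The Taylor bound for `√(1 + h)`. The sharp coefficient `1 / 2` matters: it must cancel against
the one in `J_sub_one_upper_of_hs_le_one`. -/
theorem J_sub_one_lower {A : E m →L[ℝ] E n} :
    hs A / 2 - hs A ^ 2 / 8 ≤ J A - 1 := by
  have h1 := (J_sq_bounds A).1
  have h2 := one_le_J A
  by_contra! hlt
  have h3 := hs_nonneg A
  nlinarith [sq_nonneg (hs A), mul_nonneg h3 (sq_nonneg (hs A)), sq_nonneg (hs A ^ 2),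
    sq_nonneg (J A - 1 - hs A / 2), sq_nonneg (J A - 1)]

/-- From `J - 1 = (J ^ 2 - 1) / (J + 1)` when `J ≤ 1 + T`. It serves at points of large gradient,
where no sharp constant is needed. -/
theorem J_sub_one_lower_of_hs_le {A : E m →L[ℝ] E n} {T : ℝ} (hT : hs A ≤ T) :
    hs A / (2 + T) ≤ J A - 1 := by
  have h1 := (J_sq_bounds A).1
  have h2 := one_le_J A
  have h3 := hs_nonneg A
  rw [div_le_iff₀ (by linarith)]
  by_cases h : J A ≤ 1 + T
  · nlinarith
  · push Not at h; nlinarith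

theorem J_sub_one_upper {A : E m →L[ℝ] E n} {T : ℝ} (hT : hs A ≤ T) :
    J A - 1 ≤ Real.exp T * hs A := by
  have h1 := J_le_exp A
  have h3 := hs_nonneg A
  have h4 : Real.exp (hs A / 2) - 1 ≤ hs A / 2 * Real.exp (hs A / 2) := by
    have := Real.add_one_le_exp (-(hs A / 2))
    have h5 := Real.exp_pos (hs A / 2)
    have h6 : Real.exp (hs A / 2) * Real.exp (-(hs A / 2)) = 1 := by
      rw [← Real.exp_add]; simp
    nlinarith
  have h5 : Real.exp (hs A / 2) ≤ Real.exp T := Real.exp_le_exp.2 (by linarith)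
  have h6 := Real.exp_pos T
  nlinarith [Real.exp_pos (hs A / 2)]

theorem J_sub_one_upper_of_hs_le_one {A : E m →L[ℝ] E n} (h : hs A ≤ 1) :
    J A - 1 ≤ hs A / 2 + hs A ^ 2 := by
  have h1 := J_le_exp A
  have h3 := hs_nonneg A
  have h2 := Real.abs_exp_sub_one_sub_id_le (x := hs A / 2) (by rw [abs_of_nonneg] <;> linarith)
  have := (abs_le.1 h2).2
  nlinarith

/-! ### The unit tangent vector -/

theorem rawTangent_eq (u : E m → E n) (x : E m) : ‖rawTangent u x‖ = J (fderiv ℝ u x) := by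
  refine (sq_eq_sq₀ (norm_nonneg _) (J_nonneg _)).1 ?_
  rw [← real_inner_self_eq_norm_sq, rawTangent, exteriorPower.inner_ιMulti_self, J_sq_eq_det]

theorem norm_piZero : ‖piZero m n‖ = 1 := by
  refine (sq_eq_sq₀ (norm_nonneg _) zero_le_one).1 ?_
  rw [← real_inner_self_eq_norm_sq, piZero, exteriorPower.inner_ιMulti_self]
  have : (Matrix.gram ℝ fun j : Fin m => pair (EuclideanSpace.single j (1 : ℝ)) (0 : E n)) = 1 := by
    have := gram_graph (m := m) (n := n) 0
    simp only [zero_apply] at this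
    rw [this]
    ext i j; simp [Matrix.gram_apply]
  rw [this]; simp

theorem inner_rawTangent_piZero (u : E m → E n) (x : E m) :
    ⟪rawTangent u x, piZero m n⟫ = 1 := by
  rw [rawTangent, piZero, exteriorPower.inner_ιMulti_ιMulti]
  have : (Matrix.of fun i j => ⟪pair (EuclideanSpace.single j (1 : ℝ))
      (fderiv ℝ u x (EuclideanSpace.single j 1)),
      pair (EuclideanSpace.single i (1 : ℝ)) (0 : E n)⟫) = (1 : Matrix (Fin m) (Fin m) ℝ) := by
    ext i j
    rw [Matrix.of_apply, inner_pair]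
    simp [Matrix.one_apply, EuclideanSpace.inner_single_left, eq_comm]
  rw [this]; simp

/-- Both `m`-vectors have length one and their scalar product is `1 / J`, so their squared distance
is `2 - 2 / J`. -/
theorem J_mul_excess_density (u : E m → E n) (x : E m) :
    J (fderiv ℝ u x) * ‖tangent u x - piZero m n‖ ^ 2 = 2 * (J (fderiv ℝ u x) - 1) := by
  have hJ : 0 < J (fderiv ℝ u x) := lt_of_lt_of_le one_pos (one_le_J _)
  have h1 : ⟪‖rawTangent u x‖⁻¹ • rawTangent u x, piZero m n⟫ = ‖rawTangent u x‖⁻¹ := by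
    have := real_inner_smul_left (rawTangent u x) (piZero m n) ‖rawTangent u x‖⁻¹
    rw [inner_rawTangent_piZero, mul_one] at this
    exact this
  have h2 : ‖‖rawTangent u x‖⁻¹ • rawTangent u x‖ = 1 := by
    have := norm_smul ‖rawTangent u x‖⁻¹ (rawTangent u x)
    rw [norm_inv, norm_norm, rawTangent_eq, inv_mul_cancel₀ hJ.ne', ← rawTangent_eq] at this
    exact this
  rw [tangent, @norm_sub_sq_real, norm_piZero, h1, h2, rawTangent_eq]
  field_simp
  ring

end GraphAlgebra

/-! ### Excess, minimality and rescaling in terms of the base domain -/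

section GraphIntegrals

variable {m n : ℕ}

theorem lift_lipschitz {u : E m → E n} {K : ℝ≥0} (hu : LipschitzWith K u) :
    LipschitzWith (1 + K) (lift u) := by
  refine LipschitzWith.of_dist_le_mul fun x y => ?_
  rw [dist_eq_norm, dist_eq_norm, lift, lift, pair_sub_pair]
  have h1 := hu.norm_sub_le x y
  refine (sq_le_sq₀ (norm_nonneg _) (by positivity)).1 ?_
  rw [norm_pair_sq]
  push_cast
  have h2 : ‖u x - u y‖ ^ 2 ≤ (K * ‖x - y‖) ^ 2 := by gcongr
  nlinarith [mul_nonneg K.coe_nonneg (sq_nonneg ‖x - y‖)]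

theorem hasFDerivAt_lift {u : E m → E n} {x : E m} (hu : DifferentiableAt ℝ u x) :
    HasFDerivAt (lift u) (graphL (fderiv ℝ u x)) x :=
  (pairL m n).hasFDerivAt.comp x ((hasFDerivAt_id x).prodMk hu.hasFDerivAt)

theorem differentiableAt_of_lift {u : E m → E n} {x : E m}
    (h : DifferentiableAt ℝ (lift u) x) : DifferentiableAt ℝ u x := by
  rw [differentiableAt_euclidean] at h ⊢
  intro i
  simpa [lift, pair] using h (Sum.inr i)

theorem ofReal_J (A : E m →L[ℝ] E n) : ENNReal.ofReal (J A) = jac (graphL A) := rfl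

/-- The area formula for Lipschitz graphs. -/
theorem euclideanHausdorffMeasure_graph {u : E m → E n} {K : ℝ≥0} (hu : LipschitzWith K u)
    {S : Set (E m)} (hS : MeasurableSet S) :
    μHE[m] (graph u S) = ∫⁻ x in S, ENNReal.ofReal (J (fderiv ℝ u x)) := by
  have h := euclideanHausdorffMeasure_image_eq_lintegral_jac (lift_lipschitz hu)
    (fun x y => by rw [lift, lift, pair_sub_pair]; exact norm_le_norm_pair _ _)
    (fun x hx h => by
      rw [(hasFDerivAt_lift (differentiableAt_of_lift hx)).fderiv]
      exact norm_le_norm_pair _ _) hS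
  rw [finrank_euclideanSpace_fin] at h
  rw [graph_eq_image, h]
  refine lintegral_congr_ae (ae_restrict_of_ae ?_)
  filter_upwards [hu.ae_differentiableAt (μ := (volume : Measure (E m)))] with x hx
  rw [(hasFDerivAt_lift hx).fderiv, ofReal_J]

theorem measurable_J_fderiv (u : E m → E n) : Measurable fun x => J (fderiv ℝ u x) :=
  continuous_J.measurable.comp (measurable_fderiv ℝ u)

theorem measurable_hs_fderiv (u : E m → E n) : Measurable fun x => hs (fderiv ℝ u x) :=
  continuous_hs.measurable.comp (measurable_fderiv ℝ u)

/-- The area formula identifies the Hausdorff measure on the graph with the push-forward of the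
measure of density `J`. The graph map is a measurable embedding, so `F` may be arbitrary. -/
theorem integral_graph {u : E m → E n} {K : ℝ≥0} (hu : LipschitzWith K u)
    {S : Set (E m)} (hS : MeasurableSet S) (F : E m → ℝ) :
    ∫ p in graph u S, F (base p) ∂μHE[m] = ∫ x in S, J (fderiv ℝ u x) * F x := by
  have hemb : MeasurableEmbedding (lift u) := by
    have hanti : AntilipschitzWith 1 (lift u) :=
      AntilipschitzWith.of_le_mul_dist fun x y => by
        rw [NNReal.coe_one, one_mul, dist_eq_norm, dist_eq_norm, lift, lift, pair_sub_pair]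
        exact norm_le_norm_pair _ _
    exact (hanti.isClosedEmbedding (lift_lipschitz hu).uniformContinuous).measurableEmbedding
  have hmeas := (measurable_J_fderiv u).ennreal_ofReal
  have key : (μHE[m]).restrict (graph u S) = Measure.map (lift u)
      ((volume.restrict S).withDensity fun x => ENNReal.ofReal (J (fderiv ℝ u x))) := by
    ext T hT
    rw [Measure.restrict_apply hT, hemb.map_apply, withDensity_apply _ (hemb.measurable hT),
      Measure.restrict_restrict (hemb.measurable hT), graph_eq_image,
      ← euclideanHausdorffMeasure_graph hu ((hemb.measurable hT).inter hS), graph_eq_image,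
      inter_comm (lift u ⁻¹' T), image_inter_preimage, inter_comm]
  rw [key, hemb.integral_map, integral_withDensity_eq_integral_toReal_smul hmeas (by simp)]
  refine integral_congr_ae (Filter.Eventually.of_forall fun x => ?_)
  simp [ENNReal.toReal_ofReal (J_nonneg _), lift]

theorem graph_congr {u v : E m → E n} {F : Set (E m)} (h : EqOn v u F) : graph v F = graph u F := by
  ext p
  exact and_congr_right fun hp => by rw [h hp]

theorem normExcess_eq {u v : E m → E n} {K : ℝ≥0} (hu : LipschitzWith K u) {x : E m} {r : ℝ}
    (h : EqOn v u (ball x r)) :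
    normExcess v x r = (r ^ m)⁻¹ * ∫ y in ball x r, (J (fderiv ℝ u y) - 1) := by
  have hT : ∀ y ∈ ball x r, tangent v y = tangent u y := fun y hy => by
    have : fderiv ℝ v y = fderiv ℝ u y :=
      Filter.EventuallyEq.fderiv_eq (h.eventuallyEq_of_mem (isOpen_ball.mem_nhds hy))
    rw [tangent, tangent, rawTangent, rawTangent, this]
  rw [normExcess, cylExcess, graph_congr h,
    integral_graph hu measurableSet_ball (fun y => ‖tangent v y - piZero m n‖ ^ 2),
    setIntegral_congr_fun (g := fun y => 2 * (J (fderiv ℝ u y) - 1)) measurableSet_ball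
      fun y hy => by simp only; rw [hT y hy, J_mul_excess_density],
    integral_const_mul]
  ring

theorem hs_fderiv_le {u : E m → E n} {K : ℝ≥0} (hu : LipschitzWith K u) (x : E m) :
    hs (fderiv ℝ u x) ≤ m * (K : ℝ) ^ 2 := by
  refine (hs_le_mul_norm_sq _).trans ?_
  gcongr
  exact norm_fderiv_le_of_lipschitz ℝ hu

theorem integrableOn_J {u : E m → E n} {K : ℝ≥0} (hu : LipschitzWith K u) {S : Set (E m)}
    (hS : volume S ≠ ∞) : IntegrableOn (fun x => J (fderiv ℝ u x)) S := by
  refine Measure.integrableOn_of_bounded (M := Real.exp (m * (K : ℝ) ^ 2 / 2)) hS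
    (measurable_J_fderiv u).aestronglyMeasurable (Filter.Eventually.of_forall fun x => ?_)
  rw [Real.norm_of_nonneg (J_nonneg _)]
  refine (J_le_exp _).trans (Real.exp_le_exp.2 ?_)
  have := hs_fderiv_le hu x
  linarith

theorem integrableOn_hs {u : E m → E n} {K : ℝ≥0} (hu : LipschitzWith K u) {S : Set (E m)}
    (hS : volume S ≠ ∞) : IntegrableOn (fun x => hs (fderiv ℝ u x)) S := by
  refine Measure.integrableOn_of_bounded (M := m * (K : ℝ) ^ 2) hS
    (measurable_hs_fderiv u).aestronglyMeasurable (Filter.Eventually.of_forall fun x => ?_)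
  rw [Real.norm_of_nonneg (hs_nonneg _)]
  exact hs_fderiv_le hu x

/-- `u` minimizes the area in `ball x r` among Lipschitz maps that agree with it near the
boundary. -/
def MinimizesArea (u : E m → E n) (x : E m) (r : ℝ) : Prop :=
  ∀ w : E m → E n, (∃ L, LipschitzWith L w) → ∀ s < r, (∀ y, y ∉ closedBall x s → w y = u y) →
    ∫ y in ball x r, J (fderiv ℝ u y) ≤ ∫ y in ball x r, J (fderiv ℝ w y)

theorem IsAreaMinimizing.minimizesArea {c₀ : ℝ} (hc : 0 < c₀) {u v : E m → E n} {x : E m} {r : ℝ}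
    {K : ℝ≥0} (hu : LipschitzWith K u) (hv : EqOn v u (ball x r))
    (hmin : IsAreaMinimizing c₀ v (ball x r)) : MinimizesArea u x r := by
  rintro w ⟨L, hL⟩ s hs hw
  have hg := graph_congr hv
  have hsub : closure {y ∈ ball x r | w y ≠ u y} ⊆ closedBall x s := by
    refine closure_minimal ?_ isClosed_closedBall
    rintro y ⟨-, hy⟩
    by_contra h
    exact hy (hw y h)
  -- The identity is an admissible rotation for every positive `c₀`; testing with it alone keeps all
  -- constants independent of `c₀`.
  have h := hmin 1 (one_mem _) (by simpa [hsNorm] using hc.le) (ball x r) u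
    ⟨K, hu.lipschitzOnWith⟩ (by rw [hg]; simp) w ⟨L, hL.lipschitzOnWith⟩
    ((isCompact_closedBall x s).of_isClosed_subset isClosed_closure hsub)
    (hsub.trans (closedBall_subset_ball hs))
  rw [euclideanHausdorffMeasure_graph hu measurableSet_ball,
    euclideanHausdorffMeasure_graph hL measurableSet_ball,
    ← ofReal_integral_eq_lintegral_ofReal (integrableOn_J hu measure_ball_lt_top.ne)
      (Filter.Eventually.of_forall fun _ => J_nonneg _),
    ← ofReal_integral_eq_lintegral_ofReal (integrableOn_J hL measure_ball_lt_top.ne)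
      (Filter.Eventually.of_forall fun _ => J_nonneg _)] at h
  exact (ENNReal.ofReal_le_ofReal_iff (integral_nonneg fun _ => J_nonneg _)).1 h

/-! ### Rescaling to the unit ball -/

theorem setIntegral_ball_eq (x : E m) {r : ℝ} (hr : 0 < r) (G : E m → ℝ) :
    ∫ y in ball x r, G y = r ^ m * ∫ y in ball (0 : E m) 1, G (x + r • y) := by
  have h := Measure.setIntegral_comp_smul_of_pos (volume : Measure (E m)) (fun y => G (x + y))
    (ball (0 : E m) 1) hr
  rw [smul_unitBall hr.ne', Real.norm_of_nonneg hr.le, finrank_euclideanSpace_fin, smul_eq_mul] at h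
  rw [h, ← mul_assoc, mul_inv_cancel₀ (by positivity), one_mul]
  have h2 := (measurePreserving_add_left (volume : Measure (E m)) x).setIntegral_preimage_emb
    (measurableEmbedding_addLeft x) G (ball x r)
  rw [← h2]
  congr 2
  ext y
  simp [mem_ball, dist_eq_norm]

/-- The rescaling of `u` from `ball x r` to the unit ball. -/
def rescale (u : E m → E n) (x : E m) (r : ℝ) (y : E m) : E n := r⁻¹ • u (x + r • y)

theorem fderiv_rescale (u : E m → E n) (x : E m) {r : ℝ} (hr : 0 < r) (y : E m) :
    fderiv ℝ (rescale u x r) y = fderiv ℝ u (x + r • y) := by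
  have h1 : fderiv ℝ (rescale u x r) y = r⁻¹ • fderiv ℝ (fun y => u (x + r • y)) y := by
    have : Invertible r⁻¹ := invertibleOfNonzero (inv_ne_zero hr.ne')
    exact fderiv_const_smul_of_invertible (f := fun y => u (x + r • y)) (x := y) r⁻¹
  have h2 := fderiv_comp_smul (𝕜 := ℝ) (f := fun z => u (x + z)) (x := y) r
  rw [h1, h2, smul_smul, inv_mul_cancel₀ hr.ne', one_smul, fderiv_comp_add_left]

theorem norm_rescale_sub (u : E m → E n) (x : E m) {r : ℝ} (hr : 0 < r) (y z : E m) :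
    ‖rescale u x r y - rescale u x r z‖ = r⁻¹ * ‖u (x + r • y) - u (x + r • z)‖ := by
  rw [rescale, rescale, ← smul_sub, norm_smul, norm_inv, Real.norm_of_nonneg hr.le]

theorem LipschitzOnWith.rescale {u : E m → E n} {x : E m} {r : ℝ} (hr : 0 < r) {K : ℝ≥0}
    {S T : Set (E m)} (hu : LipschitzOnWith K u S) (hT : ∀ y ∈ T, x + r • y ∈ S) :
    LipschitzOnWith K (rescale u x r) T := by
  refine LipschitzOnWith.of_dist_le_mul fun y hy z hz => ?_
  rw [dist_eq_norm, dist_eq_norm, norm_rescale_sub u x hr]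
  have h := hu.norm_sub_le (hT y hy) (hT z hz)
  have h2 : ‖x + r • y - (x + r • z)‖ = r * ‖y - z‖ := by
    rw [add_sub_add_left_eq_sub, ← smul_sub, norm_smul, Real.norm_of_nonneg hr.le]
  rw [h2] at h
  rw [inv_mul_le_iff₀ hr]
  linarith

theorem add_smul_mem_ball {x : E m} {r : ℝ} (hr : 0 < r) {t : ℝ} {y : E m} :
    x + r • y ∈ ball x (r * t) ↔ y ∈ ball (0 : E m) t := by
  rw [mem_ball, dist_eq_norm, add_sub_cancel_left, norm_smul, Real.norm_of_nonneg hr.le,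
    mem_ball_zero_iff, mul_lt_mul_iff_right₀ hr]

theorem MinimizesArea.rescale {u : E m → E n} {x : E m} {r : ℝ} (hr : 0 < r)
    (h : MinimizesArea u x r) : MinimizesArea (rescale u x r) 0 1 := by
  rintro w ⟨L, hL⟩ s hs hw
  set w' : E m → E n := fun z => r • w (r⁻¹ • (z - x)) with hw'
  have hL' : LipschitzWith L w' := by
    refine LipschitzWith.of_dist_le_mul fun y z => ?_
    have h1 := hL.norm_sub_le (r⁻¹ • (y - x)) (r⁻¹ • (z - x))
    rw [← smul_sub, sub_sub_sub_cancel_right, norm_smul, norm_inv, Real.norm_of_nonneg hr.le] at h1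
    rw [dist_eq_norm, dist_eq_norm, hw', ← smul_sub, norm_smul, Real.norm_of_nonneg hr.le]
    calc _ ≤ r * (L * (r⁻¹ * ‖y - z‖)) := by gcongr
      _ = _ := by field_simp
  have hww : AreaMinGraph.rescale w' x r = w := by
    funext y
    simp [AreaMinGraph.rescale, hw', smul_smul, hr.ne']
  have h1 := h w' ⟨L, hL'⟩ (r * s) (by nlinarith) fun z hz => by
    have : r⁻¹ • (z - x) ∉ closedBall (0 : E m) s := by
      rw [mem_closedBall_zero_iff, norm_smul, norm_inv, Real.norm_of_nonneg hr.le,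
        inv_mul_le_iff₀ hr]
      rwa [mem_closedBall, dist_eq_norm] at hz
    rw [hw']
    simp only
    rw [hw _ this, AreaMinGraph.rescale, smul_smul, mul_inv_cancel₀ hr.ne', one_smul, smul_smul,
      mul_inv_cancel₀ hr.ne', one_smul, add_sub_cancel]
  rw [setIntegral_ball_eq x hr, setIntegral_ball_eq x hr] at h1
  have h2 := le_of_mul_le_mul_left h1 (by positivity)
  simp_rw [← fderiv_rescale _ x hr, hww] at h2
  exact h2

end GraphIntegrals

/-! ### Averages over small balls and the fundamental theorem of calculus on rays -/

section Averages

variable {m n : ℕ}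

/-- The uniform probability measure on the ball of radius `δ` around the origin. -/
def unif (m : ℕ) (δ : ℝ) : Measure (E m) :=
  (volume (ball (0 : E m) δ))⁻¹ • volume.restrict (ball (0 : E m) δ)

theorem unif_isProbabilityMeasure {δ : ℝ} (hδ : 0 < δ) : IsProbabilityMeasure (unif m δ) := by
  constructor
  rw [unif, Measure.smul_apply, Measure.restrict_apply_univ, smul_eq_mul]
  exact ENNReal.inv_mul_cancel (measure_ball_pos _ _ hδ).ne' measure_ball_lt_top.ne

theorem unif_absolutelyContinuous (δ : ℝ) : unif m δ ≪ volume :=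
  (Measure.absolutelyContinuous_of_le Measure.restrict_le_self).smul_left _

theorem ae_unif_mem_ball (δ : ℝ) : ∀ᵐ h ∂unif m δ, h ∈ ball (0 : E m) δ :=
  Measure.ae_smul_measure (ae_restrict_mem measurableSet_ball) _

theorem lintegral_unif (δ : ℝ) (f : E m → ℝ≥0∞) :
    ∫⁻ h, f h ∂unif m δ = (volume (ball (0 : E m) δ))⁻¹ * ∫⁻ h in ball (0 : E m) δ, f h := by
  rw [unif, lintegral_smul_measure, smul_eq_mul]

theorem lintegral_ball_add (y : E m) (δ : ℝ) (f : E m → ℝ≥0∞) :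
    ∫⁻ h in ball (0 : E m) δ, f (y + h) = ∫⁻ z in ball y δ, f z := by
  rw [← (measurePreserving_add_left (volume : Measure (E m)) y).setLIntegral_comp_preimage_emb
    (measurableEmbedding_addLeft y) f (ball y δ)]
  congr 2
  ext z
  simp [mem_ball, dist_eq_norm]

theorem lintegral_unif_add (y : E m) (δ : ℝ) (f : E m → ℝ≥0∞) :
    ∫⁻ h, f (y + h) ∂unif m δ = (volume (ball (0 : E m) δ))⁻¹ * ∫⁻ z in ball y δ, f z := by
  rw [lintegral_unif, lintegral_ball_add]

theorem lintegral_ball_smul {t d : ℝ} (ht : 0 < t) (y : E m) (f : E m → ℝ≥0∞) :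
    ENNReal.ofReal (t ^ m) * ∫⁻ h in ball (0 : E m) d, f (y + t • h)
      = ∫⁻ z in ball y (t * d), f z := by
  have hemb : MeasurableEmbedding fun h : E m => t • h :=
    (Homeomorph.smulOfNeZero t ht.ne').measurableEmbedding
  have hmap : Measure.map (fun h : E m => t • h) volume
      = ENNReal.ofReal |(t ^ finrank ℝ (E m))⁻¹| • volume :=
    Measure.map_addHaar_smul volume ht.ne'
  have h1 : ∫⁻ h in ball (0 : E m) d, f (y + t • h)
      = ENNReal.ofReal |(t ^ finrank ℝ (E m))⁻¹| * ∫⁻ z in ball (0 : E m) (t * d), f (y + z) := by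
    have hpre : (fun h : E m => t • h) ⁻¹' (ball (0 : E m) (t * d)) = ball (0 : E m) d := by
      ext z
      simp [norm_smul, abs_of_pos ht, mul_lt_mul_iff_right₀ ht]
    rw [← smul_eq_mul, ← lintegral_smul_measure, ← Measure.restrict_smul, ← hmap,
      hemb.restrict_map, hemb.lintegral_map, hpre]
  rw [h1, lintegral_ball_add, ← mul_assoc, ← ENNReal.ofReal_mul (by positivity),
    finrank_euclideanSpace_fin, abs_of_pos (by positivity), mul_inv_cancel₀ (by positivity),
    ENNReal.ofReal_one, one_mul]

/-- The fundamental theorem of calculus on almost every ray, as an inequality. -/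
theorem ae_enorm_sub_le_lintegral {u : E m → E n} {C : ℝ≥0} (hu : LipschitzWith C u) (y : E m) :
    ∀ᵐ h : E m, ‖u (y + h) - u y‖ₑ
      ≤ ‖h‖ₑ * ∫⁻ t in Ioc (0 : ℝ) 1, ‖fderiv ℝ u (y + t • h)‖ₑ := by
  have hD : MeasurableSet {x | DifferentiableAt ℝ u x} := measurableSet_of_differentiableAt ℝ u
  have hae : ∀ᵐ x : E m, DifferentiableAt ℝ u x := hu.ae_differentiableAt
  have hφ : Measurable fun p : ℝ × E m => y + p.1 • p.2 := by fun_prop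
  -- For fixed `t > 0` the map `h ↦ y + t • h` pulls null sets back to null sets, so Fubini carries
  -- differentiability almost everywhere over to almost every point of almost every ray.
  have h1 : ∀ᵐ p ∂((volume.restrict (Ioc (0 : ℝ) 1)).prod (volume : Measure (E m))),
      DifferentiableAt ℝ u (y + p.1 • p.2) := by
    refine (Measure.ae_prod_iff_ae_ae (p := fun p : ℝ × E m =>
      DifferentiableAt ℝ u (y + p.1 • p.2)) (hφ hD)).2 ?_
    filter_upwards [ae_restrict_mem measurableSet_Ioc] with t ht
    have hq : Measure.QuasiMeasurePreserving (fun h : E m => y + t • h) volume volume := by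
      refine (measurePreserving_add_left (volume : Measure (E m)) y).quasiMeasurePreserving.comp
        ⟨by fun_prop, ?_⟩
      rw [Measure.map_addHaar_smul volume ht.1.ne']
      exact Measure.AbsolutelyContinuous.rfl.smul_left _
    exact hq.ae hae
  have h2 : ∀ᵐ h : E m, ∀ᵐ t ∂(volume.restrict (Ioc (0 : ℝ) 1)),
      DifferentiableAt ℝ u (y + t • h) := by
    have := (Measure.measurePreserving_swap (μ := (volume : Measure (E m)))
      (ν := volume.restrict (Ioc (0 : ℝ) 1))).quasiMeasurePreserving.ae h1
    exact Measure.ae_ae_of_ae_prod this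
  filter_upwards [h2] with h hh
  -- Pairing with the increment `e` reduces to a scalar absolutely continuous function whose
  -- increment is `‖e‖ ^ 2`; one factor `‖e‖` is cancelled at the end.
  set e : E n := u (y + h) - u y with he
  set φ : ℝ → ℝ := fun t => ⟪e, u (y + t • h)⟫ with hφ
  have hlip : LipschitzWith (‖e‖₊ * (C * ‖h‖₊)) φ := by
    refine LipschitzWith.of_dist_le_mul fun a b => ?_
    rw [Real.dist_eq, Real.dist_eq, hφ, ← inner_sub_right]
    refine (abs_real_inner_le_norm _ _).trans ?_
    have := hu.norm_sub_le (y + a • h) (y + b • h)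
    rw [add_sub_add_left_eq_sub, ← sub_smul, norm_smul, Real.norm_eq_abs] at this
    push_cast
    calc ‖e‖ * _ ≤ ‖e‖ * (C * (|a - b| * ‖h‖)) := by gcongr
      _ = _ := by ring
  have hac : AbsolutelyContinuousOnInterval φ 0 1 :=
    hlip.lipschitzOnWith.absolutelyContinuousOnInterval
  have hftc := hac.integral_deriv_eq_sub
  have hval : φ 1 - φ 0 = ‖e‖ * ‖e‖ := by
    simp only [hφ, one_smul, zero_smul, add_zero]
    rw [← inner_sub_right, ← he, real_inner_self_eq_norm_mul_norm]
  rw [hval, intervalIntegral.integral_of_le zero_le_one] at hftc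
  have hderiv : ∀ᵐ t ∂(volume.restrict (Ioc (0 : ℝ) 1)),
      ‖deriv φ t‖ₑ ≤ ‖e‖ₑ * (‖h‖ₑ * ‖fderiv ℝ u (y + t • h)‖ₑ) := by
    filter_upwards [hh] with t ht
    have hd : HasDerivAt (fun t : ℝ => u (y + t • h)) (fderiv ℝ u (y + t • h) h) t := by
      have hl : HasDerivAt (fun t : ℝ => y + t • h) h t := by
        simpa using ((hasDerivAt_id t).smul_const h).const_add y
      exact ht.hasFDerivAt.comp_hasDerivAt t hl
    have hd2 : HasDerivAt φ ⟪e, fderiv ℝ u (y + t • h) h⟫ t :=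
      (innerSL ℝ e).hasFDerivAt.comp_hasDerivAt t hd
    rw [hd2.deriv]
    have h3 : ‖⟪e, fderiv ℝ u (y + t • h) h⟫‖ ≤ ‖e‖ * (‖h‖ * ‖fderiv ℝ u (y + t • h)‖) := by
      refine (norm_inner_le_norm _ _).trans ?_
      gcongr
      rw [mul_comm]
      exact ContinuousLinearMap.le_opNorm _ _
    simp only [← ofReal_norm]
    rw [← ENNReal.ofReal_mul (by positivity), ← ENNReal.ofReal_mul (by positivity)]
    exact ENNReal.ofReal_le_ofReal h3
  have hmeas : Measurable fun t : ℝ => ‖fderiv ℝ u (y + t • h)‖ₑ :=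
    ((measurable_fderiv ℝ u).comp (by fun_prop : Measurable fun t : ℝ => y + t • h)).enorm
  have h4 : ‖e‖ₑ * ‖e‖ₑ ≤ ‖e‖ₑ *
      (‖h‖ₑ * ∫⁻ t in Ioc (0 : ℝ) 1, ‖fderiv ℝ u (y + t • h)‖ₑ) := by
    calc ‖e‖ₑ * ‖e‖ₑ = ‖∫ t in Ioc (0 : ℝ) 1, deriv φ t‖ₑ := by
          rw [hftc, enorm_mul, enorm_norm]
      _ ≤ ∫⁻ t in Ioc (0 : ℝ) 1, ‖deriv φ t‖ₑ := enorm_integral_le_lintegral_enorm _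
      _ ≤ ∫⁻ t in Ioc (0 : ℝ) 1, ‖e‖ₑ * (‖h‖ₑ * ‖fderiv ℝ u (y + t • h)‖ₑ) :=
          lintegral_mono_ae hderiv
      _ = _ := by rw [lintegral_const_mul _ (hmeas.const_mul _), lintegral_const_mul _ hmeas]
  by_cases he0 : e = 0
  · rw [he0]; simp
  · exact (ENNReal.mul_le_mul_iff_right (by simpa using he0) (by simp)).1 h4

/-- Integrated form: the oscillation of `u` in a ball is controlled by the averages of `Du` over
concentric balls. -/
theorem lintegral_ball_enorm_sub_le {u : E m → E n} {C : ℝ≥0} (hu : LipschitzWith C u) (y : E m)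
    {d : ℝ} {l : ℝ≥0∞}
    (hl : ∀ t, 0 < t → t ≤ d →
      ∫⁻ z in ball y t, ‖fderiv ℝ u z‖ₑ ≤ l * volume (ball (0 : E m) t)) (hd : 0 < d) :
    ∫⁻ z in ball y d, ‖u z - u y‖ₑ ≤ ENNReal.ofReal d * l * volume (ball (0 : E m) d) := by
  have hmeas : Measurable fun p : E m × ℝ => ‖fderiv ℝ u (y + p.2 • p.1)‖ₑ :=
    ((measurable_fderiv ℝ u).comp (by fun_prop : Measurable fun p : E m × ℝ => y + p.2 • p.1)).enorm
  rw [← lintegral_ball_add y d fun z => ‖u z - u y‖ₑ]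
  calc ∫⁻ h in ball (0 : E m) d, ‖u (y + h) - u y‖ₑ
      ≤ ∫⁻ h in ball (0 : E m) d, ENNReal.ofReal d *
          ∫⁻ t in Ioc (0 : ℝ) 1, ‖fderiv ℝ u (y + t • h)‖ₑ := by
        refine lintegral_mono_ae ?_
        filter_upwards [ae_restrict_of_ae (ae_enorm_sub_le_lintegral hu y),
          ae_restrict_mem measurableSet_ball] with h hh hb
        refine hh.trans (mul_le_mul_left ?_ _)
        rw [← ofReal_norm]
        exact ENNReal.ofReal_le_ofReal (mem_ball_zero_iff.1 hb).le
    _ = ENNReal.ofReal d * ∫⁻ t in Ioc (0 : ℝ) 1, ∫⁻ h in ball (0 : E m) d,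
          ‖fderiv ℝ u (y + t • h)‖ₑ := by
        rw [lintegral_const_mul _ hmeas.lintegral_prod_right',
          lintegral_lintegral_swap hmeas.aemeasurable]
    _ ≤ ENNReal.ofReal d * ∫⁻ _t in Ioc (0 : ℝ) 1, l * volume (ball (0 : E m) d) := by
        refine mul_le_mul_right (setLIntegral_mono' measurableSet_Ioc fun t ht => ?_) _
        -- For fixed `t` the inner integral lives on the ball of radius `t * d`; the Jacobian `t ^
        -- m` cancels the same factor in the volume of that ball.
        have h1 := lintegral_ball_smul (d := d) ht.1 y fun z => ‖fderiv ℝ u z‖ₑ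
        have h2 := hl (t * d) (mul_pos ht.1 hd) (by nlinarith [ht.2])
        rw [← h1, Measure.addHaar_ball_mul_of_pos volume (0 : E m) ht.1,
          finrank_euclideanSpace_fin, mul_left_comm] at h2
        exact (ENNReal.mul_le_mul_iff_right (by simpa using pow_pos ht.1 m) (by simp)).1 h2
    _ = _ := by simp [mul_assoc]

theorem sq_lintegral_le {α : Type*} [MeasurableSpace α] {μ : Measure α} [IsProbabilityMeasure μ]
    {f : α → ℝ≥0∞} (hf : AEMeasurable f μ) : (∫⁻ a, f a ∂μ) ^ 2 ≤ ∫⁻ a, f a ^ 2 ∂μ := by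
  have h := ENNReal.lintegral_mul_le_Lp_mul_Lq μ Real.HolderConjugate.two_two hf
    (aemeasurable_const (b := (1 : ℝ≥0∞)))
  simp only [Pi.mul_apply, mul_one, ENNReal.one_rpow, lintegral_const, measure_univ] at h
  calc (∫⁻ a, f a ∂μ) ^ 2 ≤ ((∫⁻ a, f a ^ (2 : ℝ) ∂μ) ^ (1 / (2 : ℝ))) ^ 2 := by gcongr
    _ = ∫⁻ a, f a ^ 2 ∂μ := by
      rw [← ENNReal.rpow_natCast, ← ENNReal.rpow_mul]
      simp

/-- The average of `u` over balls of radius `δ`. -/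
def mavg (δ : ℝ) (u : E m → E n) (y : E m) : E n := ∫ h, u (y + h) ∂unif m δ

theorem integrable_unif_of_norm_le {F : Type*} [NormedAddCommGroup F] {δ : ℝ} (hδ : 0 < δ)
    {f : E m → F} (hf : AEStronglyMeasurable f (unif m δ)) {M : ℝ}
    (hM : ∀ h ∈ ball (0 : E m) δ, ‖f h‖ ≤ M) : Integrable f (unif m δ) := by
  have := unif_isProbabilityMeasure (m := m) hδ
  exact Integrable.of_bound hf M (by filter_upwards [ae_unif_mem_ball δ] with h hh using hM h hh)

theorem integrable_unif_lipschitz {u : E m → E n} {C : ℝ≥0} (hu : LipschitzWith C u) {δ : ℝ}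
    (hδ : 0 < δ) (y : E m) : Integrable (fun h => u (y + h)) (unif m δ) := by
  refine integrable_unif_of_norm_le hδ
    (hu.continuous.comp (by fun_prop)).aestronglyMeasurable (M := ‖u y‖ + C * δ) fun h hh => ?_
  have h1 := hu.norm_sub_le (y + h) y
  rw [add_sub_cancel_left] at h1
  have h2 : ‖u (y + h)‖ ≤ ‖u y‖ + ‖u (y + h) - u y‖ := by
    conv_lhs => rw [← add_sub_cancel (u y) (u (y + h))]
    exact norm_add_le _ _
  have h3 := (mem_ball_zero_iff.1 hh).le
  have h4 : (C : ℝ) * ‖h‖ ≤ C * δ := by gcongr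
  linarith

theorem integrable_unif_fderiv {u : E m → E n} {C : ℝ≥0} (hu : LipschitzWith C u) {δ : ℝ}
    (hδ : 0 < δ) (y : E m) : Integrable (fun h => fderiv ℝ u (y + h)) (unif m δ) :=
  integrable_unif_of_norm_le hδ
    ((measurable_fderiv ℝ u).comp (measurable_const_add y)).aestronglyMeasurable
    fun _ _ => norm_fderiv_le_of_lipschitz ℝ hu

theorem mavg_lipschitz {u : E m → E n} {C : ℝ≥0} (hu : LipschitzWith C u) {δ : ℝ} (hδ : 0 < δ) :
    LipschitzWith C (mavg δ u) := by
  have := unif_isProbabilityMeasure (m := m) hδ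
  refine LipschitzWith.of_dist_le_mul fun y z => ?_
  rw [dist_eq_norm, mavg, mavg, ← integral_sub (integrable_unif_lipschitz hu hδ y)
    (integrable_unif_lipschitz hu hδ z), dist_eq_norm]
  refine (norm_integral_le_of_norm_le_const (C := C * ‖y - z‖)
    (Filter.Eventually.of_forall fun h => ?_)).trans (by simp)
  simpa using hu.norm_sub_le (y + h) (z + h)

theorem hasFDerivAt_mavg {u : E m → E n} {C : ℝ≥0} (hu : LipschitzWith C u) {δ : ℝ} (hδ : 0 < δ)
    (y : E m) : HasFDerivAt (mavg δ u) (∫ h, fderiv ℝ u (y + h) ∂unif m δ) y := by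
  have := unif_isProbabilityMeasure (m := m) hδ
  refine (hasFDerivAt_integral_of_dominated_loc_of_lip (F := fun y h => u (y + h))
    (F' := fun h => fderiv ℝ u (y + h)) (bound := fun _ => (C : ℝ)) (s := univ)
    Filter.univ_mem ?_ (integrable_unif_lipschitz hu hδ y)
    (integrable_unif_fderiv hu hδ y).aestronglyMeasurable ?_ (integrable_const _) ?_).2
  · exact Filter.Eventually.of_forall fun z =>
      (hu.continuous.comp (by fun_prop)).aestronglyMeasurable
  · refine Filter.Eventually.of_forall fun h => ?_
    refine LipschitzOnWith.of_dist_le_mul fun a _ b _ => ?_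
    simpa [dist_eq_norm] using hu.norm_sub_le (a + h) (b + h)
  · refine (unif_absolutelyContinuous δ).ae_le ?_
    have hq := (measurePreserving_add_left (volume : Measure (E m)) y).quasiMeasurePreserving.ae
      (hu.ae_differentiableAt (μ := (volume : Measure (E m))))
    filter_upwards [hq] with h hh
    exact (hasFDerivAt_comp_add_right h).2 hh.hasFDerivAt

/-- Averaging over small balls does not increase integrals. -/
theorem lintegral_lintegral_unif_le {δ : ℝ} (hδ : 0 < δ) {f : E m → ℝ≥0∞} (hf : Measurable f)
    {S S' : Set (E m)} (h : ∀ y ∈ S, ball y δ ⊆ S') {t : ℝ} (ht0 : 0 ≤ t) (ht : t ≤ 1) :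
    ∫⁻ y in S, ∫⁻ h, f (y + t • h) ∂unif m δ ≤ ∫⁻ y in S', f y := by
  have := unif_isProbabilityMeasure (m := m) hδ
  have hm : Measurable fun p : E m × E m => f (p.1 + t • p.2) := hf.comp (by fun_prop)
  rw [lintegral_lintegral_swap hm.aemeasurable]
  calc ∫⁻ h, (∫⁻ y in S, f (y + t • h)) ∂unif m δ ≤ ∫⁻ _h, (∫⁻ y in S', f y) ∂unif m δ := by
        refine lintegral_mono_ae ?_
        filter_upwards [ae_unif_mem_ball δ] with k hk
        rw [← (measurePreserving_add_right (volume : Measure (E m))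
          (t • k)).setLIntegral_comp_preimage_emb (measurableEmbedding_addRight (t • k)) f S']
        refine lintegral_mono_set fun y hy => ?_
        refine h y hy ?_
        rw [mem_ball, dist_eq_norm, add_sub_cancel_left, norm_smul, Real.norm_of_nonneg ht0]
        have := mem_ball_zero_iff.1 hk
        nlinarith [norm_nonneg k]
    _ = _ := by simp

/-- A Poincaré type estimate: Jensen and the bound along rays control the difference pointwise, and
Fubini turns the translates by `t • h` into an integral over `S'`. The factor `δ ^ 2` will offset
the squared slope of the cutoff. -/
theorem lintegral_enorm_mavg_sub_sq_le {u : E m → E n} {C : ℝ≥0} (hu : LipschitzWith C u) {δ : ℝ}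
    (hδ : 0 < δ) {S S' : Set (E m)} (h : ∀ y ∈ S, ball y δ ⊆ S') :
    ∫⁻ y in S, ‖mavg δ u y - u y‖ₑ ^ 2
      ≤ ENNReal.ofReal (δ ^ 2) * ∫⁻ y in S', ‖fderiv ℝ u y‖ₑ ^ 2 := by
  have := unif_isProbabilityMeasure (m := m) hδ
  have hprob : IsProbabilityMeasure (volume.restrict (Ioc (0 : ℝ) 1)) := ⟨by simp⟩
  set f : E m → ℝ≥0∞ := fun z => ‖fderiv ℝ u z‖ₑ with hf
  have hfm : Measurable f := (measurable_fderiv ℝ u).enorm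
  have hpt : ∀ y, ‖mavg δ u y - u y‖ₑ ^ 2 ≤ ENNReal.ofReal (δ ^ 2) *
      ∫⁻ t in Ioc (0 : ℝ) 1, ∫⁻ h, f (y + t • h) ^ 2 ∂unif m δ := by
    intro y
    have hmy : Measurable fun p : E m × ℝ => f (y + p.2 • p.1) ^ 2 :=
      (hfm.comp (by fun_prop)).pow_const 2
    have h1 : mavg δ u y - u y = ∫ h, (u (y + h) - u y) ∂unif m δ := by
      rw [integral_sub (integrable_unif_lipschitz hu hδ y) (integrable_const _)]
      simp [mavg]
    calc ‖mavg δ u y - u y‖ₑ ^ 2 ≤ (∫⁻ h, ‖u (y + h) - u y‖ₑ ∂unif m δ) ^ 2 := by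
          rw [h1]; gcongr; exact enorm_integral_le_lintegral_enorm _
      _ ≤ ∫⁻ h, ‖u (y + h) - u y‖ₑ ^ 2 ∂unif m δ := by
          refine sq_lintegral_le (Continuous.aemeasurable ?_)
          have := hu.continuous
          fun_prop
      _ ≤ ∫⁻ h, (ENNReal.ofReal (δ ^ 2) *
          ∫⁻ t in Ioc (0 : ℝ) 1, f (y + t • h) ^ 2) ∂unif m δ := by
          refine lintegral_mono_ae ?_
          filter_upwards [(unif_absolutelyContinuous δ).ae_le (ae_enorm_sub_le_lintegral hu y),
            ae_unif_mem_ball δ] with k hk hb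
          have h2 : ‖k‖ₑ ≤ ENNReal.ofReal δ := by
            rw [← ofReal_norm]
            exact ENNReal.ofReal_le_ofReal (mem_ball_zero_iff.1 hb).le
          calc ‖u (y + k) - u y‖ₑ ^ 2
              ≤ (ENNReal.ofReal δ * ∫⁻ t in Ioc (0 : ℝ) 1, f (y + t • k)) ^ 2 := by
                gcongr
                exact hk.trans (mul_le_mul_left h2 _)
            _ ≤ _ := by
                rw [mul_pow, ENNReal.ofReal_pow hδ.le]
                gcongr
                exact sq_lintegral_le (hfm.comp (by fun_prop)).aemeasurable
      _ = _ := by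
          rw [lintegral_const_mul _ hmy.lintegral_prod_right',
            lintegral_lintegral_swap hmy.aemeasurable]
  calc ∫⁻ y in S, ‖mavg δ u y - u y‖ₑ ^ 2
      ≤ ∫⁻ y in S, ENNReal.ofReal (δ ^ 2) *
        ∫⁻ t in Ioc (0 : ℝ) 1, ∫⁻ h, f (y + t • h) ^ 2 ∂unif m δ := lintegral_mono fun y => hpt y
    _ = ENNReal.ofReal (δ ^ 2) *
        ∫⁻ t in Ioc (0 : ℝ) 1, ∫⁻ y in S, ∫⁻ h, f (y + t • h) ^ 2 ∂unif m δ := by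
        have hm2 : Measurable fun p : E m × ℝ => ∫⁻ h, f (p.1 + p.2 • h) ^ 2 ∂unif m δ := by
          have : Measurable fun q : (E m × ℝ) × E m => f (q.1.1 + q.1.2 • q.2) ^ 2 :=
            (hfm.comp (by fun_prop)).pow_const 2
          exact this.lintegral_prod_right'
        rw [lintegral_const_mul _ hm2.lintegral_prod_right',
          lintegral_lintegral_swap hm2.aemeasurable]
    _ ≤ ENNReal.ofReal (δ ^ 2) * ∫⁻ _t in Ioc (0 : ℝ) 1, ∫⁻ y in S', f y ^ 2 := by
        refine mul_le_mul_right (setLIntegral_mono' measurableSet_Ioc fun t ht => ?_) _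
        exact lintegral_lintegral_unif_le hδ (hfm.pow_const 2) h ht.1.le ht.2
    _ = _ := by simp [hf]

end Averages

/-! ### Maximal function and Lipschitz estimates -/

section Maximal

variable {m n : ℕ}

theorem volume_ball_mul {t : ℝ} (ht : 0 < t) (d : ℝ) :
    volume (ball (0 : E m) (t * d)) = ENNReal.ofReal (t ^ m) * volume (ball (0 : E m) d) := by
  rw [Measure.addHaar_ball_mul_of_pos volume (0 : E m) ht, finrank_euclideanSpace_fin]

/-- The weak type estimate for the maximal function at scales at most `δ`. -/
theorem exists_measurableSet_maximal_le {f : E m → ℝ≥0∞} {S S' : Set (E m)} {δ : ℝ}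
    (hS : ∀ y ∈ S, ball y δ ⊆ S') (l : ℝ≥0∞) :
    ∃ N : Set (E m), MeasurableSet N ∧ l * volume N ≤ 4 ^ m * ∫⁻ y in S', f y ∧
      ∀ y ∈ S \ N, ∀ t, 0 < t → t ≤ δ →
        ∫⁻ z in ball y t, f z ≤ l * volume (ball (0 : E m) t) := by
  set B : Set (E m) := {y | y ∈ S ∧ ∃ t, 0 < t ∧ t ≤ δ ∧
    l * volume (ball (0 : E m) t) < ∫⁻ z in ball y t, f z} with hB
  have hch : ∀ y : E m, ∃ t, y ∈ B → 0 < t ∧ t ≤ δ ∧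
      l * volume (ball (0 : E m) t) < ∫⁻ z in ball y t, f z := fun y => by
    by_cases hy : y ∈ B
    · obtain ⟨t, ht⟩ := hy.2
      exact ⟨t, fun _ => ht⟩
    · exact ⟨0, fun h => absurd h hy⟩
  choose r hr using hch
  -- Vitali covering with enlargement factor `4`, the source of the constant `4 ^ m`.
  obtain ⟨v, hvB, hdisj, hcov⟩ := Vitali.exists_disjoint_subfamily_covering_enlargement_closedBall
    B id r δ (fun a ha => (hr a ha).2.1) 4 (by norm_num)
  simp only [id] at hdisj hcov
  have hcount : v.Countable := hdisj.countable_of_nonempty_interior fun a ha =>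
    ⟨a, ball_subset_interior_closedBall (mem_ball_self (hr a (hvB ha)).1)⟩
  refine ⟨toMeasurable volume B, measurableSet_toMeasurable _ _, ?_, fun y hy t ht htδ => ?_⟩
  · rw [measure_toMeasurable]
    have hsub : B ⊆ ⋃ b ∈ v, closedBall b (4 * r b) := fun a ha => by
      obtain ⟨b, hb, hab⟩ := hcov a ha
      exact mem_biUnion hb (hab (mem_closedBall_self (hr a ha).1.le))
    have : Countable v := hcount.to_subtype
    calc l * volume B ≤ l * ∑' b : v, volume (closedBall (b : E m) (4 * r b)) := by
          gcongr
          exact (measure_mono hsub).trans (measure_biUnion_le _ hcount _)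
      _ = ∑' b : v, 4 ^ m * (l * volume (ball (0 : E m) (r b))) := by
          rw [← ENNReal.tsum_mul_left]
          refine tsum_congr fun b => ?_
          have hb := (hr b (hvB b.2)).1
          rw [Measure.addHaar_closedBall _ _ (by positivity), mul_pow,
            Measure.addHaar_ball_of_pos _ _ hb, finrank_euclideanSpace_fin,
            ENNReal.ofReal_mul (by positivity)]
          rw [ENNReal.ofReal_pow (by norm_num : (0 : ℝ) ≤ 4)]
          simp only [ENNReal.ofReal_ofNat]
          ring
      _ ≤ ∑' b : v, 4 ^ m * ∫⁻ z in ball (b : E m) (r b), f z :=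
          ENNReal.tsum_le_tsum fun b => mul_le_mul_right (hr b (hvB b.2)).2.2.le _
      _ = 4 ^ m * ∫⁻ z in ⋃ b : v, ball (b : E m) (r b), f z := by
          rw [ENNReal.tsum_mul_left, lintegral_iUnion (fun b => measurableSet_ball)]
          intro a b hab
          exact (hdisj a.2 b.2 (fun h => hab (Subtype.ext h))).mono ball_subset_closedBall
            ball_subset_closedBall
      _ ≤ _ := by
          refine mul_le_mul_right (lintegral_mono_set (iUnion_subset fun b => ?_)) _
          exact (ball_subset_ball (hr b (hvB b.2)).2.1).trans (hS b (hvB b.2).1)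
  · by_contra! hlt
    exact hy.2 (subset_toMeasurable _ _ ⟨hy.1, t, ht, htδ, hlt⟩)

/-- Average the triangle inequality over the ball of radius `d / 2` around the midpoint, which lies
in the `d`-balls around both points. The volume ratio `2 ^ m` and the two terms give `2 ^ (m + 1)`.
-/
theorem norm_sub_le_of_maximal_le {u : E m → E n} {C : ℝ≥0} (hu : LipschitzWith C u)
    {y z : E m} {l : ℝ} (hl : 0 ≤ l) (hyz : y ≠ z)
    (hy : ∀ t, 0 < t → t ≤ ‖y - z‖ → ∫⁻ x in ball y t, ‖fderiv ℝ u x‖ₑ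
      ≤ ENNReal.ofReal l * volume (ball (0 : E m) t))
    (hz : ∀ t, 0 < t → t ≤ ‖y - z‖ → ∫⁻ x in ball z t, ‖fderiv ℝ u x‖ₑ
      ≤ ENNReal.ofReal l * volume (ball (0 : E m) t)) :
    ‖u y - u z‖ ≤ 2 ^ (m + 1) * l * ‖y - z‖ := by
  set d := ‖y - z‖ with hd
  have hd0 : 0 < d := norm_pos_iff.2 (sub_ne_zero.2 hyz)
  have h1 := lintegral_ball_enorm_sub_le hu y hy hd0
  have h2 := lintegral_ball_enorm_sub_le hu z hz hd0
  set M : Set (E m) := ball (midpoint ℝ y z) (2⁻¹ * d) with hM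
  have hMy : M ⊆ ball y d := ball_subset_ball' (by
    rw [dist_midpoint_left, dist_eq_norm, ← hd]; norm_num; linarith)
  have hMz : M ⊆ ball z d := ball_subset_ball' (by
    rw [dist_midpoint_right, dist_eq_norm, ← hd]; norm_num; linarith)
  have hcont := hu.continuous
  have h3 : ‖u y - u z‖ₑ * volume M ≤ 2 * (ENNReal.ofReal d * ENNReal.ofReal l
      * volume (ball (0 : E m) d)) := by
    calc ‖u y - u z‖ₑ * volume M = ∫⁻ _x in M, ‖u y - u z‖ₑ := by rw [setLIntegral_const]
      _ ≤ ∫⁻ x in M, (‖u x - u y‖ₑ + ‖u x - u z‖ₑ) := by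
          refine lintegral_mono fun x => ?_
          have : u y - u z = -(u x - u y) + (u x - u z) := by abel
          rw [this]
          exact (enorm_add_le _ _).trans (by rw [enorm_neg])
      _ = (∫⁻ x in M, ‖u x - u y‖ₑ) + ∫⁻ x in M, ‖u x - u z‖ₑ :=
          lintegral_add_left (by fun_prop) _
      _ ≤ _ := by
          rw [two_mul]
          exact add_le_add ((lintegral_mono_set hMy).trans h1) ((lintegral_mono_set hMz).trans h2)
  have hMv : volume M = ENNReal.ofReal ((2⁻¹ : ℝ) ^ m) * volume (ball (0 : E m) d) := by
    rw [hM, Measure.addHaar_ball_center, volume_ball_mul (by norm_num)]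
  have hv0 : volume (ball (0 : E m) d) ≠ 0 := (measure_ball_pos _ _ hd0).ne'
  have hvt : volume (ball (0 : E m) d) ≠ ∞ := measure_ball_lt_top.ne
  rw [hMv, ← mul_assoc, ← mul_assoc] at h3
  have h4 := (ENNReal.mul_le_mul_iff_left hv0 hvt).1 h3
  have h5 := ENNReal.toReal_mono (by finiteness) h4
  simp only [ENNReal.toReal_mul, toReal_enorm, ENNReal.toReal_ofNat,
    ENNReal.toReal_ofReal hd0.le, ENNReal.toReal_ofReal hl,
    ENNReal.toReal_ofReal (by positivity : (0 : ℝ) ≤ 2⁻¹ ^ m)] at h5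
  rw [inv_pow, ← div_eq_mul_inv, div_le_iff₀ (by positivity)] at h5
  calc _ ≤ _ := h5
    _ = _ := by ring

theorem norm_mavg_sub_le {u : E m → E n} {C : ℝ≥0} (hu : LipschitzWith C u) {δ : ℝ} (hδ : 0 < δ)
    {y : E m} {l : ℝ} (hl : 0 ≤ l)
    (hy : ∀ t, 0 < t → t ≤ δ → ∫⁻ x in ball y t, ‖fderiv ℝ u x‖ₑ
      ≤ ENNReal.ofReal l * volume (ball (0 : E m) t)) :
    ‖mavg δ u y - u y‖ ≤ δ * l := by
  have := unif_isProbabilityMeasure (m := m) hδ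
  have h1 := lintegral_ball_enorm_sub_le hu y hy hδ
  have h2 : mavg δ u y - u y = ∫ h, (u (y + h) - u y) ∂unif m δ := by
    rw [integral_sub (integrable_unif_lipschitz hu hδ y) (integrable_const _)]
    simp [mavg]
  have hv0 : volume (ball (0 : E m) δ) ≠ 0 := (measure_ball_pos _ _ hδ).ne'
  have hvt : volume (ball (0 : E m) δ) ≠ ∞ := measure_ball_lt_top.ne
  have h3 : ‖mavg δ u y - u y‖ₑ ≤ ENNReal.ofReal (δ * l) := by
    rw [h2]
    refine (enorm_integral_le_lintegral_enorm _).trans ?_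
    rw [lintegral_unif_add y δ fun z => ‖u z - u y‖ₑ]
    calc _ ≤ (volume (ball (0 : E m) δ))⁻¹ *
          (ENNReal.ofReal δ * ENNReal.ofReal l * volume (ball (0 : E m) δ)) :=
          mul_le_mul_right h1 _
      _ = _ := by
          rw [mul_comm, mul_assoc, ENNReal.mul_inv_cancel hv0 hvt, mul_one, ENNReal.ofReal_mul hδ.le]
  rw [← ofReal_norm] at h3
  exact (ENNReal.ofReal_le_ofReal_iff (by positivity)).1 h3

/-- A Lipschitz estimate on the set where the maximal function of `Du` at scales at most `δ` is
bounded by `l`. -/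
theorem norm_sub_le_of_maximal_le_of_fderiv_mavg_le {u : E m → E n} {C : ℝ≥0}
    (hu : LipschitzWith C u) {δ : ℝ} (hδ : 0 < δ) {l Λ : ℝ} (hl : 0 ≤ l) (hΛ : 0 ≤ Λ)
    {A K : Set (E m)} (hA : Convex ℝ A) (hKA : K ⊆ A)
    (hK : ∀ y ∈ K, ∀ t, 0 < t → t ≤ δ → ∫⁻ x in ball y t, ‖fderiv ℝ u x‖ₑ
      ≤ ENNReal.ofReal l * volume (ball (0 : E m) t))
    (hAΛ : ∀ y ∈ A, ‖∫ h, fderiv ℝ u (y + h) ∂unif m δ‖ ≤ Λ) :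
    ∀ y ∈ K, ∀ z ∈ K, ‖u y - u z‖ ≤ (2 ^ (m + 1) * l + Λ) * ‖y - z‖ := by
  intro y hy z hz
  rcases eq_or_ne y z with rfl | hyz
  · simp
  -- Up to distance `δ` the maximal function suffices. Beyond it, replace `u` by its average, at a
  -- cost `δ * l ≤ ‖y - z‖ * l` at either end, and apply the mean value inequality on the convex set
  -- `A`.
  rcases le_or_gt ‖y - z‖ δ with hd | hd
  · have h := norm_sub_le_of_maximal_le hu hl hyz (fun t h0 ht => hK y hy t h0 (ht.trans hd))
      fun t h0 ht => hK z hz t h0 (ht.trans hd)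
    have := mul_nonneg hΛ (norm_nonneg (y - z))
    linarith
  · have h1 := norm_mavg_sub_le hu hδ hl (hK y hy)
    have h2 := norm_mavg_sub_le hu hδ hl (hK z hz)
    have h3 := hA.norm_image_sub_le_of_norm_hasFDerivWithin_le
      (fun x _ => (hasFDerivAt_mavg hu hδ x).hasFDerivWithinAt) hAΛ (hKA hz) (hKA hy)
    have h4 : u y - u z = (mavg δ u y - mavg δ u z) - (mavg δ u y - u y) + (mavg δ u z - u z) := by
      abel
    have h5 : ‖u y - u z‖ ≤ Λ * ‖y - z‖ + δ * l + δ * l := by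
      rw [h4]
      exact (norm_add_le _ _).trans (add_le_add ((norm_sub_le _ _).trans (add_le_add h3 h1)) h2)
    have h6 : δ * l ≤ ‖y - z‖ * l := by gcongr
    have h7 : (2 : ℝ) ≤ 2 ^ (m + 1) := by
      rw [pow_succ]; nlinarith [one_le_pow₀ (one_le_two (α := ℝ)) (n := m)]
    have h8 := mul_le_mul_of_nonneg_right h7 (mul_nonneg hl (norm_nonneg (y - z)))
    nlinarith

end Maximal

/-! ### Behaviour of the energy under averaging -/

section Energy

variable {m n : ℕ}

theorem hs_add_le (A B : E m →L[ℝ] E n) {θ : ℝ} (hθ : 0 < θ) :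
    hs (A + B) ≤ (1 + θ) * hs A + (1 + θ⁻¹) * hs B := by
  rw [hs, hs, hs, Finset.mul_sum, Finset.mul_sum, ← Finset.sum_add_distrib]
  refine Finset.sum_le_sum fun i _ => ?_
  set a := A (EuclideanSpace.single i 1)
  set b := B (EuclideanSpace.single i 1)
  have h1 : ‖a + b‖ ^ 2 ≤ (‖a‖ + ‖b‖) ^ 2 := by gcongr; exact norm_add_le _ _
  have h2 : 2 * ‖a‖ * ‖b‖ ≤ θ * ‖a‖ ^ 2 + θ⁻¹ * ‖b‖ ^ 2 := by
    have h3 := mul_nonneg (inv_pos.2 hθ).le (sq_nonneg (θ * ‖a‖ - ‖b‖))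
    have h4 : θ⁻¹ * (θ * ‖a‖ - ‖b‖) ^ 2
        = θ * ‖a‖ ^ 2 + θ⁻¹ * ‖b‖ ^ 2 - 2 * ‖a‖ * ‖b‖ := by field_simp; ring
    linarith
  rw [add_apply]
  nlinarith

theorem hs_smul (t : ℝ) (A : E m →L[ℝ] E n) : hs (t • A) = t ^ 2 * hs A := by
  rw [hs, hs, Finset.mul_sum]
  refine Finset.sum_congr rfl fun i _ => ?_
  rw [smul_apply, norm_smul, mul_pow, Real.norm_eq_abs, sq_abs]

@[simp] theorem hs_zero : hs (0 : E m →L[ℝ] E n) = 0 := by simp [hs]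

theorem ofReal_hs (A : E m →L[ℝ] E n) :
    ENNReal.ofReal (hs A) = ∑ i, ‖A (EuclideanSpace.single i 1)‖ₑ ^ 2 := by
  rw [hs, ENNReal.ofReal_sum_of_nonneg fun _ _ => by positivity]
  refine Finset.sum_congr rfl fun i _ => ?_
  rw [ENNReal.ofReal_pow (norm_nonneg _), ofReal_norm]

/-- Jensen's inequality, applied to each column of the matrix. -/
theorem ofReal_hs_integral_le {α : Type*} [MeasurableSpace α] {μ : Measure α}
    [IsProbabilityMeasure μ] {f : α → E m →L[ℝ] E n} (hf : Integrable f μ) :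
    ENNReal.ofReal (hs (∫ a, f a ∂μ)) ≤ ∫⁻ a, ENNReal.ofReal (hs (f a)) ∂μ := by
  have hfi : ∀ i : Fin m, Integrable (fun a => f a (EuclideanSpace.single i 1)) μ := fun i =>
    hf.apply_continuousLinearMap _
  simp_rw [ofReal_hs]
  rw [lintegral_finsetSum' _ fun i _ => ((hfi i).aestronglyMeasurable.enorm.pow_const 2)]
  refine Finset.sum_le_sum fun i _ => ?_
  rw [ContinuousLinearMap.integral_apply hf]
  calc _ ≤ (∫⁻ a, ‖f a (EuclideanSpace.single i 1)‖ₑ ∂μ) ^ 2 := by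
        gcongr; exact enorm_integral_le_lintegral_enorm _
    _ ≤ _ := sq_lintegral_le (hfi i).aestronglyMeasurable.enorm

theorem fderiv_mavg {u : E m → E n} {C : ℝ≥0} (hu : LipschitzWith C u) {δ : ℝ} (hδ : 0 < δ)
    (y : E m) : fderiv ℝ (mavg δ u) y = ∫ h, fderiv ℝ u (y + h) ∂unif m δ :=
  (hasFDerivAt_mavg hu hδ y).fderiv

theorem setIntegral_le_of_lintegral_le {α : Type*} [MeasurableSpace α] {μ : Measure α}
    {f g : α → ℝ} {S S' : Set α} (hf : IntegrableOn f S μ) (hg : IntegrableOn g S' μ)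
    (hf0 : ∀ a, 0 ≤ f a) (hg0 : ∀ a, 0 ≤ g a)
    (h : ∫⁻ a in S, ENNReal.ofReal (f a) ∂μ ≤ ∫⁻ a in S', ENNReal.ofReal (g a) ∂μ) :
    ∫ a in S, f a ∂μ ≤ ∫ a in S', g a ∂μ := by
  rw [← ofReal_integral_eq_lintegral_ofReal hf (Filter.Eventually.of_forall hf0),
    ← ofReal_integral_eq_lintegral_ofReal hg (Filter.Eventually.of_forall hg0)] at h
  exact (ENNReal.ofReal_le_ofReal_iff (integral_nonneg hg0)).1 h

variable {u : E m → E n} {C : ℝ≥0}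

theorem setIntegral_hs_mavg_le (hu : LipschitzWith C u) {δ : ℝ} (hδ : 0 < δ) {S S' : Set (E m)}
    (hS : volume S ≠ ∞) (hS' : volume S' ≠ ∞) (h : ∀ y ∈ S, ball y δ ⊆ S') :
    ∫ y in S, hs (fderiv ℝ (mavg δ u) y) ≤ ∫ y in S', hs (fderiv ℝ u y) := by
  have := unif_isProbabilityMeasure (m := m) hδ
  refine setIntegral_le_of_lintegral_le (integrableOn_hs (mavg_lipschitz hu hδ) hS)
    (integrableOn_hs hu hS') (fun _ => hs_nonneg _) (fun _ => hs_nonneg _) ?_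
  refine le_trans (lintegral_mono fun y => ?_) (lintegral_lintegral_unif_le hδ
    (measurable_hs_fderiv u).ennreal_ofReal h zero_le_one le_rfl)
  simp only [one_smul]
  rw [fderiv_mavg hu hδ]
  exact ofReal_hs_integral_le (integrable_unif_fderiv hu hδ y)

theorem volumeReal_ball_pos {δ : ℝ} (hδ : 0 < δ) : 0 < volume.real (ball (0 : E m) δ) :=
  ENNReal.toReal_pos (measure_ball_pos _ _ hδ).ne' measure_ball_lt_top.ne

theorem norm_mavg_sub_self_le (hu : LipschitzWith C u) {δ : ℝ} (hδ : 0 < δ) (y : E m) :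
    ‖mavg δ u y - u y‖ ≤ C * δ := by
  have := unif_isProbabilityMeasure (m := m) hδ
  have h2 : mavg δ u y - u y = ∫ h, (u (y + h) - u y) ∂unif m δ := by
    rw [integral_sub (integrable_unif_lipschitz hu hδ y) (integrable_const _)]
    simp [mavg]
  rw [h2]
  refine (norm_integral_le_of_norm_le_const (C := C * δ) ?_).trans (by simp)
  filter_upwards [ae_unif_mem_ball δ] with k hk
  have h3 := hu.norm_sub_le (y + k) y
  rw [add_sub_cancel_left] at h3
  refine h3.trans ?_
  gcongr
  exact (mem_ball_zero_iff.1 hk).le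

theorem setIntegral_norm_mavg_sub_sq_le (hu : LipschitzWith C u) {δ : ℝ} (hδ : 0 < δ)
    {S S' : Set (E m)} (hS : volume S ≠ ∞) (hS' : volume S' ≠ ∞) (h : ∀ y ∈ S, ball y δ ⊆ S') :
    ∫ y in S, ‖mavg δ u y - u y‖ ^ 2 ≤ δ ^ 2 * ∫ y in S', hs (fderiv ℝ u y) := by
  have := unif_isProbabilityMeasure (m := m) hδ
  rw [← integral_const_mul]
  have hcont : Continuous fun y => ‖mavg δ u y - u y‖ ^ 2 :=
    (((mavg_lipschitz hu hδ).continuous.sub hu.continuous).norm).pow 2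
  refine setIntegral_le_of_lintegral_le ?_ ((integrableOn_hs hu hS').const_mul _)
    (fun _ => by positivity) (fun _ => mul_nonneg (sq_nonneg _) (hs_nonneg _)) ?_
  · refine Measure.integrableOn_of_bounded (M := (C * δ) ^ 2) hS hcont.aestronglyMeasurable
      (Filter.Eventually.of_forall fun y => ?_)
    rw [norm_pow, norm_norm]
    gcongr
    exact norm_mavg_sub_self_le hu hδ y
  · have h1 := lintegral_enorm_mavg_sub_sq_le hu hδ h
    calc _ = ∫⁻ y in S, ‖mavg δ u y - u y‖ₑ ^ 2 := by
          refine lintegral_congr fun y => ?_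
          rw [ENNReal.ofReal_pow (norm_nonneg _), ofReal_norm]
      _ ≤ _ := h1
      _ ≤ _ := by
          simp_rw [ENNReal.ofReal_mul (sq_nonneg δ)]
          rw [lintegral_const_mul _ (measurable_hs_fderiv u).ennreal_ofReal]
          refine mul_le_mul_right (lintegral_mono fun y => ?_) _
          rw [← ofReal_norm, ← ENNReal.ofReal_pow (norm_nonneg _)]
          exact ENNReal.ofReal_le_ofReal (norm_sq_le_hs _)

/-- An average over a small ball inside `S'` is controlled by the integral over `S'`. -/
theorem lintegral_unif_le {δ : ℝ} (hδ : 0 < δ) {g : E m → ℝ} {S' : Set (E m)}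
    (hg : IntegrableOn g S') (hg0 : ∀ y, 0 ≤ g y) {y : E m} (hy : ball y δ ⊆ S') :
    ∫⁻ h, ENNReal.ofReal (g (y + h)) ∂unif m δ ≤
      ENNReal.ofReal ((∫ z in S', g z) / volume.real (ball (0 : E m) δ)) := by
  have hv0 : 0 < volume.real (ball (0 : E m) δ) := volumeReal_ball_pos hδ
  rw [lintegral_unif_add y δ fun z => ENNReal.ofReal (g z), ENNReal.ofReal_div_of_pos hv0,
    ofReal_integral_eq_lintegral_ofReal hg (Filter.Eventually.of_forall hg0),
    Measure.real, ENNReal.ofReal_toReal measure_ball_lt_top.ne, mul_comm, ENNReal.div_eq_inv_mul,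
    mul_comm]
  exact mul_le_mul_right (lintegral_mono_set hy) _

theorem hs_fderiv_mavg_le (hu : LipschitzWith C u) {δ : ℝ} (hδ : 0 < δ) {S' : Set (E m)}
    (hS' : volume S' ≠ ∞) {y : E m} (hy : ball y δ ⊆ S') :
    hs (fderiv ℝ (mavg δ u) y)
      ≤ (∫ z in S', hs (fderiv ℝ u z)) / volume.real (ball (0 : E m) δ) := by
  have := unif_isProbabilityMeasure (m := m) hδ
  have h1 := (ofReal_hs_integral_le (integrable_unif_fderiv hu hδ y)).trans
    (lintegral_unif_le hδ (integrableOn_hs hu hS') (fun _ => hs_nonneg _) hy)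
  rw [fderiv_mavg hu hδ]
  exact (ENNReal.ofReal_le_ofReal_iff (div_nonneg (integral_nonneg fun _ => hs_nonneg _)
    measureReal_nonneg)).1 h1

/-- The set where the energy density of `u` is at most `κ`. -/
def lowSet (u : E m → E n) (κ : ℝ) : Set (E m) := {y | hs (fderiv ℝ u y) ≤ κ}

theorem measurableSet_lowSet (u : E m → E n) (κ : ℝ) : MeasurableSet (lowSet u κ) :=
  measurableSet_le (measurable_hs_fderiv u) measurable_const

/-- At steep points the gradient is dominated linearly by the energy density, as in Chebyshev's
inequality. This is what makes the averaged steep part quadratic in the energy. -/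
theorem norm_le_of_notMem_lowSet {κ : ℝ} (hκ : 0 < κ) {y : E m} (hy : y ∉ lowSet u κ) :
    ‖fderiv ℝ u y‖ ≤ (Real.sqrt κ)⁻¹ * hs (fderiv ℝ u y) := by
  have h1 : κ < hs (fderiv ℝ u y) := not_le.1 hy
  have h2 := norm_le_sqrt_hs (fderiv ℝ u y)
  have h3 : Real.sqrt κ ≤ Real.sqrt (hs (fderiv ℝ u y)) := Real.sqrt_le_sqrt h1.le
  have h4 := Real.sq_sqrt (hs_nonneg (fderiv ℝ u y))
  have h5 := Real.sqrt_pos.2 hκ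
  rw [le_inv_mul_iff₀ h5]
  nlinarith [Real.sqrt_nonneg (hs (fderiv ℝ u y))]

/-- Up to small errors, averaging does not increase the energy of the part of the map with small
gradient, and the part with large gradient is negligible. -/
theorem setIntegral_hs_mavg_le_lowSet (hu : LipschitzWith C u) {δ : ℝ} (hδ : 0 < δ)
    {S S' D : Set (E m)} (hSm : volume S ≠ ∞) (hD : volume D ≠ ∞)
    (hS'D : S' ⊆ D)
    (h : ∀ y ∈ S, ball y δ ⊆ S') {θ κ : ℝ} (hθ : 0 < θ) (hκ : 0 < κ) (hSmeas : MeasurableSet S) :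
    ∫ y in S, hs (fderiv ℝ (mavg δ u) y) ≤
      (1 + θ) * (∫ y in S' ∩ lowSet u κ, hs (fderiv ℝ u y)) +
      (1 + θ⁻¹) * (m * (κ⁻¹ * ((∫ z in D, hs (fderiv ℝ u z)) /
        volume.real (ball (0 : E m) δ)) ^ 2)) * volume.real S := by
  have := unif_isProbabilityMeasure (m := m) hδ
  set K := lowSet u κ with hK
  have hKm : MeasurableSet K := measurableSet_lowSet u κ
  set Γ := (∫ z in D, hs (fderiv ℝ u z)) / volume.real (ball (0 : E m) δ) with hΓ
  have hΓ0 : 0 ≤ Γ := div_nonneg (integral_nonneg fun _ => hs_nonneg _) measureReal_nonneg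
  set f₁ : E m → E m →L[ℝ] E n := K.indicator (fderiv ℝ u) with hf₁
  set f₂ : E m → E m →L[ℝ] E n := Kᶜ.indicator (fderiv ℝ u) with hf₂
  have hfm : Measurable (fderiv ℝ u) := measurable_fderiv ℝ u
  have hb : ∀ z, ‖fderiv ℝ u z‖ ≤ C := fun z => norm_fderiv_le_of_lipschitz ℝ hu
  have hi₁ : ∀ y, Integrable (fun h => f₁ (y + h)) (unif m δ) := fun y =>
    integrable_unif_of_norm_le hδ
      ((hfm.indicator hKm).comp (measurable_const_add y)).aestronglyMeasurable
      fun _ _ => (norm_indicator_le_norm_self _ _).trans (hb _)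
  have hi₂ : ∀ y, Integrable (fun h => f₂ (y + h)) (unif m δ) := fun y =>
    integrable_unif_of_norm_le hδ
      ((hfm.indicator hKm.compl).comp (measurable_const_add y)).aestronglyMeasurable
      fun _ _ => (norm_indicator_le_norm_self _ _).trans (hb _)
  have hsplit : ∀ y, fderiv ℝ (mavg δ u) y
      = (∫ h, f₁ (y + h) ∂unif m δ) + ∫ h, f₂ (y + h) ∂unif m δ := fun y => by
    rw [fderiv_mavg hu hδ, ← integral_add (hi₁ y) (hi₂ y)]
    congr 1
    funext h
    exact (congrFun (indicator_self_add_compl K (fderiv ℝ u)) (y + h)).symm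
  have hint : IntegrableOn (fun y => hs (fderiv ℝ u y)) D := integrableOn_hs hu hD
  -- The average of the steep gradient has norm at most `κ ^ (-1/2) * Γ`; squaring after averaging,
  -- rather than before, yields `Γ ^ 2`.
  have hf₂le : ∀ y ∈ S, hs (∫ h, f₂ (y + h) ∂unif m δ) ≤ m * (κ⁻¹ * Γ ^ 2) := by
    intro y hy
    have h1 : ‖∫ h, f₂ (y + h) ∂unif m δ‖ₑ ≤ ENNReal.ofReal ((Real.sqrt κ)⁻¹ * Γ) := by
      calc _ ≤ ∫⁻ h, ‖f₂ (y + h)‖ₑ ∂unif m δ := enorm_integral_le_lintegral_enorm _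
        _ ≤ ∫⁻ h, ENNReal.ofReal ((Real.sqrt κ)⁻¹ * hs (fderiv ℝ u (y + h))) ∂unif m δ := by
            refine lintegral_mono fun k => ?_
            rw [← ofReal_norm]
            refine ENNReal.ofReal_le_ofReal ?_
            by_cases hk : y + k ∈ K
            · have : f₂ (y + k) = 0 := indicator_of_notMem (by simpa using hk) _
              rw [this, norm_zero]
              have := hs_nonneg (fderiv ℝ u (y + k))
              positivity
            · have : f₂ (y + k) = fderiv ℝ u (y + k) := indicator_of_mem (by simpa using hk) _
              rw [this]
              exact norm_le_of_notMem_lowSet hκ hk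
        _ ≤ ENNReal.ofReal ((∫ z in D, (Real.sqrt κ)⁻¹ * hs (fderiv ℝ u z)) /
              volume.real (ball (0 : E m) δ)) :=
            lintegral_unif_le hδ (g := fun z => (Real.sqrt κ)⁻¹ * hs (fderiv ℝ u z))
              (hint.const_mul _) (fun z => mul_nonneg (by positivity) (hs_nonneg _))
              ((h y hy).trans hS'D)
        _ = _ := by rw [integral_const_mul, mul_div_assoc]
    rw [← ofReal_norm, ENNReal.ofReal_le_ofReal_iff (by positivity)] at h1
    refine (hs_le_mul_norm_sq _).trans ?_
    gcongr
    calc _ ≤ ((Real.sqrt κ)⁻¹ * Γ) ^ 2 := by gcongr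
      _ = _ := by rw [mul_pow, inv_pow, Real.sq_sqrt hκ.le]
  have hpt : ∀ y ∈ S, ENNReal.ofReal (hs (fderiv ℝ (mavg δ u) y)) ≤
      ENNReal.ofReal (1 + θ) * ENNReal.ofReal (hs (∫ h, f₁ (y + h) ∂unif m δ)) +
      ENNReal.ofReal ((1 + θ⁻¹) * (m * (κ⁻¹ * Γ ^ 2))) := by
    intro y hy
    rw [← ENNReal.ofReal_mul (by positivity), ← ENNReal.ofReal_add
      (mul_nonneg (by positivity) (hs_nonneg _)) (by positivity)]
    refine ENNReal.ofReal_le_ofReal ?_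
    rw [hsplit]
    refine (hs_add_le _ _ hθ).trans ?_
    gcongr
    exact hf₂le y hy
  have hKint : IntegrableOn (fun y => hs (fderiv ℝ u y)) (S' ∩ K) :=
    hint.mono_set (inter_subset_left.trans hS'D)
  have hf₁int : ∫⁻ y in S, ENNReal.ofReal (hs (∫ h, f₁ (y + h) ∂unif m δ))
      ≤ ENNReal.ofReal (∫ y in S' ∩ K, hs (fderiv ℝ u y)) := by
    rw [ofReal_integral_eq_lintegral_ofReal hKint (Filter.Eventually.of_forall fun _ => hs_nonneg _)]
    have hm : Measurable (K.indicator fun y => ENNReal.ofReal (hs (fderiv ℝ u y))) :=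
      (measurable_hs_fderiv u).ennreal_ofReal.indicator hKm
    refine (lintegral_mono fun y => ?_).trans
      ((lintegral_lintegral_unif_le hδ hm h zero_le_one le_rfl).trans_eq ?_)
    · refine (ofReal_hs_integral_le (hi₁ y)).trans_eq (lintegral_congr fun k => ?_)
      rw [one_smul]
      by_cases hk : y + k ∈ K
      · rw [indicator_of_mem hk, hf₁, indicator_of_mem hk]
      · rw [indicator_of_notMem hk, hf₁, indicator_of_notMem hk]; simp
    · rw [lintegral_indicator hKm, Measure.restrict_restrict hKm, inter_comm]
  have hI0 : 0 ≤ ∫ y in S' ∩ K, hs (fderiv ℝ u y) := integral_nonneg fun _ => hs_nonneg _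
  have key : ENNReal.ofReal (∫ y in S, hs (fderiv ℝ (mavg δ u) y)) ≤
      ENNReal.ofReal ((1 + θ) * (∫ y in S' ∩ K, hs (fderiv ℝ u y)) +
      (1 + θ⁻¹) * (m * (κ⁻¹ * Γ ^ 2)) * volume.real S) := by
    rw [ofReal_integral_eq_lintegral_ofReal (integrableOn_hs (mavg_lipschitz hu hδ) hSm)
      (Filter.Eventually.of_forall fun _ => hs_nonneg _)]
    refine (setLIntegral_mono' hSmeas hpt).trans ?_
    rw [lintegral_add_right _ measurable_const, lintegral_const_mul' _ _ ENNReal.ofReal_ne_top,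
      setLIntegral_const, ENNReal.ofReal_add (by positivity)
        (mul_nonneg (by positivity) measureReal_nonneg), ENNReal.ofReal_mul (p := 1 + θ) (by positivity),
      ENNReal.ofReal_mul (p := (1 + θ⁻¹) * (m * (κ⁻¹ * Γ ^ 2))) (by positivity), Measure.real,
      ENNReal.ofReal_toReal hSm]
    gcongr
  exact (ENNReal.ofReal_le_ofReal_iff (add_nonneg (by positivity)
    (mul_nonneg (by positivity) measureReal_nonneg))).1 key

end Energy

/-! ### The averaged competitor and the energy of steep points -/

section Competitor

variable {m n : ℕ}

/-- The radial cutoff that is `1` on `ball 0 s` and `0` outside `ball 0 (s + δ)`. -/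
def cutoff (s δ : ℝ) (y : E m) : ℝ := max 0 (min 1 (δ⁻¹ * (s + δ - ‖y‖)))

theorem cutoff_nonneg (s δ : ℝ) (y : E m) : 0 ≤ cutoff s δ y := le_max_left _ _

theorem cutoff_le_one (s δ : ℝ) (y : E m) : cutoff s δ y ≤ 1 :=
  max_le zero_le_one (min_le_left _ _)

theorem cutoff_eq_one {s δ : ℝ} (hδ : 0 < δ) {y : E m} (hy : ‖y‖ ≤ s) : cutoff s δ y = 1 := by
  have : 1 ≤ δ⁻¹ * (s + δ - ‖y‖) := by rw [le_inv_mul_iff₀ hδ]; linarith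
  rw [cutoff, min_eq_left this, max_eq_right zero_le_one]

theorem cutoff_eq_zero {s δ : ℝ} (hδ : 0 < δ) {y : E m} (hy : s + δ ≤ ‖y‖) : cutoff s δ y = 0 := by
  have : δ⁻¹ * (s + δ - ‖y‖) ≤ 0 :=
    mul_nonpos_of_nonneg_of_nonpos (inv_pos.2 hδ).le (by linarith)
  rw [cutoff, max_eq_left ((min_le_right _ _).trans this)]

theorem cutoff_lipschitz (s : ℝ) {δ : ℝ} (hδ : 0 < δ) :
    LipschitzWith (Real.toNNReal δ⁻¹) (cutoff (m := m) s δ) := by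
  have h : LipschitzWith (Real.toNNReal δ⁻¹) fun y : E m => δ⁻¹ * (s + δ - ‖y‖) := by
    refine LipschitzWith.of_dist_le_mul fun y z => ?_
    rw [Real.dist_eq, ← mul_sub, abs_mul, abs_of_pos (inv_pos.2 hδ),
      Real.coe_toNNReal _ (inv_pos.2 hδ).le, sub_sub_sub_cancel_left, dist_eq_norm]
    have := abs_norm_sub_norm_le z y
    rw [norm_sub_rev z y] at this
    gcongr
  exact (h.const_min 1).const_max 0

/-- The interpolation between the averages of `u` in `ball 0 s` and `u` outside
`ball 0 (s + δ)`. -/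
def competitor (u : E m → E n) (s δ : ℝ) (y : E m) : E n :=
  u y + cutoff s δ y • (mavg δ u y - u y)

variable {u : E m → E n} {C : ℝ≥0}

/-- The cutoff has slope `1 / δ`, but it multiplies a difference of size at most `C * δ`. Hence the
constant does not deteriorate with `δ`: `C` from `u`, `C` from the cutoff, `2 * C` from the
difference. -/
theorem competitor_lipschitz (hu : LipschitzWith C u) (s : ℝ) {δ : ℝ} (hδ : 0 < δ) :
    LipschitzWith (4 * C) (competitor u s δ) := by
  have hw : LipschitzWith (C + C) fun y => mavg δ u y - u y := (mavg_lipschitz hu hδ).sub hu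
  have hη : LipschitzWith (C + (C + C)) fun y => cutoff s δ y • (mavg δ u y - u y) := by
    refine LipschitzWith.of_dist_le_mul fun y z => ?_
    rw [dist_eq_norm, dist_eq_norm]
    set a := cutoff s δ y
    set b := cutoff s δ z
    set p := mavg δ u y - u y
    set q := mavg δ u z - u z
    have h1 : a • p - b • q = (a - b) • q + a • (p - q) := by module
    have h2 : |a - b| ≤ δ⁻¹ * ‖y - z‖ := by
      have := (cutoff_lipschitz (m := m) s hδ).dist_le_mul y z
      rwa [Real.dist_eq, Real.coe_toNNReal _ (inv_pos.2 hδ).le, dist_eq_norm] at this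
    have h3 : ‖q‖ ≤ C * δ := norm_mavg_sub_self_le hu hδ z
    have h4 : ‖p - q‖ ≤ (C + C : ℝ≥0) * ‖y - z‖ := hw.norm_sub_le y z
    have h5 : |a| ≤ 1 := by
      rw [abs_of_nonneg (cutoff_nonneg _ _ _)]; exact cutoff_le_one _ _ _
    rw [h1]
    refine (norm_add_le _ _).trans ?_
    rw [norm_smul, norm_smul, Real.norm_eq_abs, Real.norm_eq_abs]
    calc |a - b| * ‖q‖ + |a| * ‖p - q‖
        ≤ (δ⁻¹ * ‖y - z‖) * (C * δ) + 1 * ((C + C : ℝ≥0) * ‖y - z‖) := by gcongr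
      _ = _ := by push_cast; field_simp
  have := hu.add hη
  have e : C + (C + (C + C)) = 4 * C := by ring
  rw [e] at this
  exact this

theorem competitor_eq_of_notMem (u : E m → E n) {s δ : ℝ} (hδ : 0 < δ) {y : E m}
    (hy : y ∉ closedBall (0 : E m) (s + δ)) : competitor u s δ y = u y := by
  rw [mem_closedBall_zero_iff, not_le] at hy
  rw [competitor, cutoff_eq_zero hδ hy.le, zero_smul, add_zero]

theorem competitor_eq_mavg (u : E m → E n) {s δ : ℝ} (hδ : 0 < δ) {y : E m}
    (hy : y ∈ ball (0 : E m) s) : competitor u s δ y = mavg δ u y := by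
  rw [mem_ball_zero_iff] at hy
  rw [competitor, cutoff_eq_one hδ hy.le, one_smul, add_sub_cancel]

/-- By the product rule the derivative is a convex combination of the two gradients plus a rank one
term from the cutoff; `hs_add_le` with `θ = 1`, used twice, gives the factors. -/
theorem ae_hs_fderiv_competitor_le (hu : LipschitzWith C u) (s : ℝ) {δ : ℝ} (hδ : 0 < δ) :
    ∀ᵐ y : E m, hs (fderiv ℝ (competitor u s δ) y) ≤
      4 * hs (fderiv ℝ u y) + 4 * hs (fderiv ℝ (mavg δ u) y)
        + 2 * m * (δ ^ 2)⁻¹ * ‖mavg δ u y - u y‖ ^ 2 := by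
  filter_upwards [hu.ae_differentiableAt (μ := (volume : Measure (E m))),
    (cutoff_lipschitz (m := m) s hδ).ae_differentiableAt (μ := (volume : Measure (E m)))]
    with y hy hη
  have hw := (hasFDerivAt_mavg hu hδ y).differentiableAt.hasFDerivAt.sub hy.hasFDerivAt
  have hd := hy.hasFDerivAt.add (hη.hasFDerivAt.smul hw)
  set A := fderiv ℝ u y
  set B := fderiv ℝ (mavg δ u) y
  set t := cutoff s δ y
  set w := mavg δ u y - u y
  set D : E m →L[ℝ] E n := (fderiv ℝ (cutoff s δ) y).smulRight w
  have ht0 : 0 ≤ t := cutoff_nonneg _ _ _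
  have ht1 : t ≤ 1 := cutoff_le_one _ _ _
  have hfd : fderiv ℝ (competitor u s δ) y = ((1 - t) • A + t • B) + D := by
    refine (HasFDerivAt.fderiv hd).trans ?_
    ext h : 1
    simp only [add_apply, smul_apply, sub_apply, ContinuousLinearMap.smulRight_apply, D, A, B, w, t,
      Pi.sub_apply]
    module
  have h1 := hs_add_le ((1 - t) • A + t • B) D one_pos
  have h2 := hs_add_le ((1 - t) • A) (t • B) one_pos
  rw [hs_smul, hs_smul] at h2
  have h3 : (1 - t) ^ 2 * hs A ≤ hs A := by
    refine mul_le_of_le_one_left (hs_nonneg _) ?_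
    nlinarith
  have h4 : t ^ 2 * hs B ≤ hs B := mul_le_of_le_one_left (hs_nonneg _) (by nlinarith)
  have h5 : hs D ≤ m * (δ ^ 2)⁻¹ * ‖w‖ ^ 2 := by
    refine (hs_le_mul_norm_sq _).trans ?_
    have h6 : ‖D‖ ≤ δ⁻¹ * ‖w‖ := by
      rw [ContinuousLinearMap.norm_smulRight_apply]
      gcongr
      have := norm_fderiv_le_of_lipschitz ℝ (cutoff_lipschitz (m := m) s hδ) (x₀ := y)
      rwa [Real.coe_toNNReal _ (inv_pos.2 hδ).le] at this
    calc (m : ℝ) * ‖D‖ ^ 2 ≤ m * (δ⁻¹ * ‖w‖) ^ 2 := by gcongr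
      _ = _ := by rw [mul_pow, inv_pow]; ring
  rw [hfd]
  norm_num at h1 h2
  linarith

/-- The one-layer energy inequality: the energy carried by the points of large gradient in
`ball 0 s` is controlled by small multiples of the total energy and by the energy in an annulus. -/
theorem exists_energy_lowSet_compl_le (m n : ℕ) (C : ℝ≥0) :
    ∃ M > (0 : ℝ), ∀ u : E m → E n, LipschitzWith C u → MinimizesArea u 0 1 →
      ∀ s δ θ κ Γ : ℝ, 0 < δ → s + 2 * δ ≤ 1 → 0 < θ → θ ≤ 1 → 0 < κ → κ ≤ 1 →
      Γ = (∫ y in ball (0 : E m) 1, hs (fderiv ℝ u y)) / volume.real (ball (0 : E m) δ) → Γ ≤ 1 →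
      ∫ y in ball (0 : E m) s \ lowSet u κ, hs (fderiv ℝ u y) ≤
        M * ((θ + κ + Γ) * (∫ y in ball (0 : E m) 1, hs (fderiv ℝ u y))
          + (∫ y in ball (0 : E m) (s + 2 * δ) \ ball (0 : E m) (s - δ), hs (fderiv ℝ u y))
          + θ⁻¹ * κ⁻¹ * Γ ^ 2) := by
  set T : ℝ := m * (C : ℝ) ^ 2 with hT
  have hT0 : 0 ≤ T := by positivity
  set T' : ℝ := m * ((4 * C : ℝ≥0) : ℝ) ^ 2 with hT'
  set vB : ℝ := volume.real (ball (0 : E m) 1) with hvB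
  have hvB0 : 0 ≤ vB := measureReal_nonneg
  set P : ℝ := Real.exp T' * (8 + 2 * m) with hP
  have hP0 : 0 ≤ P := by positivity
  refine ⟨(2 + T) * (1 + P + m * vB + 1), by positivity, ?_⟩
  intro u hu hmin s δ θ κ Γ hδ hs1 hθ hθ1 hκ hκ1 hΓ hΓ1
  set z := competitor u s δ with hz
  have hzL : LipschitzWith (4 * C) z := competitor_lipschitz hu s hδ
  have hwL : LipschitzWith C (mavg δ u) := mavg_lipschitz hu hδ
  set B : Set (E m) := ball 0 1 with hB
  set V : Set (E m) := closedBall 0 (s + δ) with hV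
  set U : Set (E m) := ball 0 s with hU
  set L : Set (E m) := V \ U with hL
  set A : Set (E m) := ball (0 : E m) (s + 2 * δ) \ ball (0 : E m) (s - δ) with hA
  set S' : Set (E m) := ball (0 : E m) (s + δ) with hS'
  set K := lowSet u κ with hK
  have hKm : MeasurableSet K := measurableSet_lowSet u κ
  have hVB : V ⊆ B := closedBall_subset_ball (by linarith)
  have hUV : U ⊆ V := ball_subset_closedBall.trans (closedBall_subset_closedBall (by linarith))
  have hUB : U ⊆ B := hUV.trans hVB
  have hS'B : S' ⊆ B := ball_subset_ball (by linarith)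
  have hAB : A ⊆ B := sdiff_subset.trans (ball_subset_ball hs1)
  -- `A` is the layer widened by `δ` on both sides, so averages taken at points of the layer see
  -- only the energy in `A`.
  have hLA : ∀ y ∈ L, ball y δ ⊆ A := by
    rintro y ⟨h1, h2⟩ x hx
    rw [hV, mem_closedBall_zero_iff] at h1
    rw [hU, mem_ball_zero_iff, not_lt] at h2
    rw [mem_ball, dist_eq_norm] at hx
    have h3 := norm_sub_norm_le x y
    have h4 := norm_sub_norm_le y x
    rw [norm_sub_rev] at h4
    refine ⟨?_, ?_⟩
    · rw [mem_ball_zero_iff]; linarith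
    · rw [mem_ball_zero_iff]; linarith
  have hLA' : L ⊆ A := fun y hy => hLA y hy (mem_ball_self hδ)
  have hUS' : ∀ y ∈ U, ball y δ ⊆ S' := fun y hy => ball_subset_ball' (by
    rw [dist_zero_right]; have := mem_ball_zero_iff.1 hy; linarith)
  have hfin : ∀ {W : Set (E m)}, W ⊆ B → volume W ≠ ∞ := fun h =>
    (measure_mono h).trans_lt measure_ball_lt_top |>.ne
  have hUm : MeasurableSet U := measurableSet_ball
  have hLm : MeasurableSet L := measurableSet_closedBall.diff measurableSet_ball
  have hVm : MeasurableSet V := measurableSet_closedBall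
  set g : E m → ℝ := fun y => hs (fderiv ℝ u y) with hg
  set G : E m → ℝ := fun y => hs (fderiv ℝ (mavg δ u) y) with hG
  have hg0 : ∀ y, 0 ≤ g y := fun _ => hs_nonneg _
  have hG0 : ∀ y, 0 ≤ G y := fun _ => hs_nonneg _
  have hgi : ∀ {W : Set (E m)}, W ⊆ B → IntegrableOn g W := fun h => integrableOn_hs hu (hfin h)
  have hGi : ∀ {W : Set (E m)}, W ⊆ B → IntegrableOn G W := fun h => integrableOn_hs hwL (hfin h)
  have hJi : ∀ {W : Set (E m)}, W ⊆ B → IntegrableOn (fun y => J (fderiv ℝ u y)) W :=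
    fun h => integrableOn_J hu (hfin h)
  have hJz : ∀ {W : Set (E m)}, W ⊆ B → IntegrableOn (fun y => J (fderiv ℝ z y)) W :=
    fun h => integrableOn_J hzL (hfin h)
  set I := ∫ y in B, g y with hI
  have hI0 : 0 ≤ I := integral_nonneg hg0
  have hmono : ∀ {W W' : Set (E m)}, W ⊆ W' → W' ⊆ B → ∫ y in W, g y ≤ ∫ y in W', g y :=
    fun h h' => setIntegral_mono_set (hgi h') (Filter.Eventually.of_forall hg0)
      (Filter.Eventually.of_forall h)
  -- comparison on the region where the competitor differs from `u`
  have hmin' : 0 ≤ (∫ y in U, (J (fderiv ℝ (mavg δ u) y) - J (fderiv ℝ u y)))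
      + ∫ y in L, (J (fderiv ℝ z y) - J (fderiv ℝ u y)) := by
    have h1 := hmin z ⟨_, hzL⟩ (s + δ) (by linarith) fun y hy => competitor_eq_of_notMem u hδ hy
    have h2 : 0 ≤ ∫ y in B, (J (fderiv ℝ z y) - J (fderiv ℝ u y)) := by
      rw [integral_sub (hJz Subset.rfl) (hJi Subset.rfl)]; linarith
    have hout : ∀ y ∈ B \ V, J (fderiv ℝ z y) - J (fderiv ℝ u y) = 0 := fun y hy => by
      have : z =ᶠ[nhds y] u := Filter.eventuallyEq_of_mem
        (isClosed_closedBall.isOpen_compl.mem_nhds hy.2) fun x hx => competitor_eq_of_notMem u hδ hx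
      rw [this.fderiv_eq, sub_self]
    have hin : ∀ y ∈ U, J (fderiv ℝ z y) - J (fderiv ℝ u y)
        = J (fderiv ℝ (mavg δ u) y) - J (fderiv ℝ u y) := fun y hy => by
      have : z =ᶠ[nhds y] mavg δ u := Filter.eventuallyEq_of_mem
        (isOpen_ball.mem_nhds hy) fun x hx => competitor_eq_mavg u hδ hx
      rw [this.fderiv_eq]
    have hFi : ∀ {W : Set (E m)}, W ⊆ B →
        IntegrableOn (fun y => J (fderiv ℝ z y) - J (fderiv ℝ u y)) W := fun h =>
      (hJz h).sub (hJi h)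
    rw [← inter_union_sdiff B V, inter_eq_right.2 hVB,
      setIntegral_union disjoint_sdiff_right (measurableSet_ball.diff hVm) (hFi hVB)
        (hFi sdiff_subset), setIntegral_eq_zero_of_forall_eq_zero hout, add_zero,
      ← inter_union_sdiff V U, inter_eq_right.2 hUV,
      setIntegral_union disjoint_sdiff_right hLm (hFi hUB) (hFi (sdiff_subset.trans hVB)),
      setIntegral_congr_fun hUm hin] at h2
    exact h2
  -- the layer
  have hlayer : ∫ y in L, (J (fderiv ℝ z y) - J (fderiv ℝ u y)) ≤ P * ∫ y in A, g y := by
    have hLB : L ⊆ B := hLA'.trans hAB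
    have hwi : IntegrableOn (fun y => ‖mavg δ u y - u y‖ ^ 2) L :=
      ((((hwL.continuous.sub hu.continuous).norm).pow 2).continuousOn.integrableOn_compact
        (isCompact_closedBall (0 : E m) (s + δ))).mono_set sdiff_subset
    have h1 : ∫ y in L, (J (fderiv ℝ z y) - J (fderiv ℝ u y)) ≤
        ∫ y in L, Real.exp T' * (4 * g y + 4 * G y
          + 2 * m * (δ ^ 2)⁻¹ * ‖mavg δ u y - u y‖ ^ 2) := by
      refine integral_mono_ae ((hJz hLB).sub (hJi hLB)) ?_ ?_
      · exact ((((hgi hLB).const_mul 4).add ((hGi hLB).const_mul 4)).add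
          (hwi.const_mul _)).const_mul _
      · filter_upwards [ae_restrict_of_ae (ae_hs_fderiv_competitor_le hu s hδ)] with y hy
        have h2 := J_sub_one_upper (hs_fderiv_le hzL y)
        have h3 := one_le_J (fderiv ℝ u y)
        have h4 := mul_le_mul_of_nonneg_left hy (Real.exp_pos T').le
        simp only [hg, hG]
        linarith
    have h2 : ∫ y in L, G y ≤ ∫ y in A, g y := setIntegral_hs_mavg_le hu hδ (hfin hLB) (hfin hAB) hLA
    have h3 : ∫ y in L, ‖mavg δ u y - u y‖ ^ 2 ≤ δ ^ 2 * ∫ y in A, g y :=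
      setIntegral_norm_mavg_sub_sq_le hu hδ (hfin hLB) (hfin hAB) hLA
    have h4 : ∫ y in L, g y ≤ ∫ y in A, g y := hmono hLA' hAB
    refine h1.trans ?_
    have i1 : IntegrableOn (fun y => 4 * g y + 4 * G y) L :=
      ((hgi hLB).const_mul 4).add ((hGi hLB).const_mul 4)
    rw [integral_const_mul, integral_add i1 (hwi.const_mul _), integral_add ((hgi hLB).const_mul 4) ((hGi hLB).const_mul 4),
      integral_const_mul, integral_const_mul, integral_const_mul, hP,
      mul_assoc (Real.exp T')]
    have h5 : 2 * (m : ℝ) * (δ ^ 2)⁻¹ * (∫ y in L, ‖mavg δ u y - u y‖ ^ 2)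
        ≤ 2 * m * ∫ y in A, g y := by
      calc _ ≤ 2 * (m : ℝ) * (δ ^ 2)⁻¹ * (δ ^ 2 * ∫ y in A, g y) := by gcongr
        _ = _ := by field_simp
    refine mul_le_mul_of_nonneg_left ?_ (Real.exp_pos T').le
    linarith
  -- the inner ball, from above
  have hΓ0 : 0 ≤ Γ := by rw [hΓ]; exact div_nonneg hI0 measureReal_nonneg
  have hGΓ : ∀ y ∈ U, G y ≤ Γ := fun y hy => by
    rw [hΓ]; exact hs_fderiv_mavg_le hu hδ (hfin Subset.rfl) ((hUS' y hy).trans hS'B)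
  have hone : ∀ {W : Set (E m)}, W ⊆ B → IntegrableOn (fun _ : E m => (1 : ℝ)) W := fun h =>
    integrableOn_const (hfin h)
  -- The averaged map has energy density at most `Γ ≤ 1`, so its area is half its energy up to the
  -- relative error `Γ`.
  have hupper : ∫ y in U, (J (fderiv ℝ (mavg δ u) y) - 1) ≤ (1 / 2 + Γ) * ∫ y in U, G y := by
    rw [← integral_const_mul]
    refine setIntegral_mono_on ((integrableOn_J hwL (hfin hUB)).sub (hone hUB))
      ((hGi hUB).const_mul _) hUm fun y hy => ?_
    have h1 := hGΓ y hy
    have h2 := J_sub_one_upper_of_hs_le_one (A := fderiv ℝ (mavg δ u) y) (h1.trans hΓ1)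
    have h3 := mul_le_mul_of_nonneg_right h1 (hG0 y)
    simp only [hG] at h3 ⊢
    nlinarith
  have hGI : ∫ y in U, G y ≤ I :=
    (setIntegral_hs_mavg_le hu hδ (hfin hUB) (hfin hS'B) hUS').trans (hmono hS'B Subset.rfl)
  have hGlow : ∫ y in U, G y ≤ (1 + θ) * (∫ y in S' ∩ K, g y)
      + (1 + θ⁻¹) * (m * (κ⁻¹ * Γ ^ 2)) * volume.real U := by
    have := setIntegral_hs_mavg_le_lowSet hu hδ (hfin hUB) (hfin Subset.rfl) hS'B hUS' hθ hκ hUm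
    rw [hΓ]; exact this
  have hvU : volume.real U ≤ vB := measureReal_mono hUB (hfin Subset.rfl)
  have hS'K : ∫ y in S' ∩ K, g y ≤ (∫ y in U ∩ K, g y) + ∫ y in A, g y := by
    have hsub : S' ∩ K ⊆ (U ∩ K) ∪ A := by
      rintro y ⟨h1, h2⟩
      by_cases hyU : y ∈ U
      · exact Or.inl ⟨hyU, h2⟩
      · exact Or.inr (hLA' ⟨ball_subset_closedBall h1, hyU⟩)
    have hUKB : U ∩ K ⊆ B := inter_subset_left.trans hUB
    refine (hmono hsub (union_subset hUKB hAB)).trans ?_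
    have hdisj : Disjoint (U ∩ K) (A \ (U ∩ K)) := disjoint_sdiff_right
    rw [← union_sdiff_self, setIntegral_union hdisj
      ((measurableSet_ball.diff measurableSet_ball).diff (hUm.inter hKm)) (hgi hUKB)
      (hgi (sdiff_subset.trans hAB))]
    have := hmono (sdiff_subset : A \ (U ∩ K) ⊆ A) hAB
    linarith
  -- the inner ball, from below
  have hUK : U ∩ K ⊆ B := inter_subset_left.trans hUB
  have hUnK : U \ K ⊆ B := sdiff_subset.trans hUB
  have hlow1 : (1 / 2 - κ / 8) * (∫ y in U ∩ K, g y) ≤ ∫ y in U ∩ K, (J (fderiv ℝ u y) - 1) := by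
    rw [← integral_const_mul]
    refine setIntegral_mono_on ((hgi hUK).const_mul _) ((hJi hUK).sub (hone hUK))
      (hUm.inter hKm) fun y hy => ?_
    have h1 : g y ≤ κ := hy.2
    have h2 := J_sub_one_lower (A := fderiv ℝ u y)
    have h3 := mul_le_mul_of_nonneg_right h1 (hg0 y)
    simp only [hg] at h3 ⊢
    nlinarith
  have hlow2 : (2 + T)⁻¹ * (∫ y in U \ K, g y) ≤ ∫ y in U \ K, (J (fderiv ℝ u y) - 1) := by
    rw [← integral_const_mul]
    refine setIntegral_mono_on ((hgi hUnK).const_mul _) ((hJi hUnK).sub (hone hUnK))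
      (hUm.diff hKm) fun y _ => ?_
    have := J_sub_one_lower_of_hs_le (hs_fderiv_le hu y)
    simp only [hg]
    rwa [div_eq_inv_mul] at this
  have hsplit : ∫ y in U, (J (fderiv ℝ u y) - 1)
      = (∫ y in U ∩ K, (J (fderiv ℝ u y) - 1)) + ∫ y in U \ K, (J (fderiv ℝ u y) - 1) := by
    conv_lhs => rw [← inter_union_sdiff U K]
    exact setIntegral_union (disjoint_sdiff_right.mono_left inter_subset_right) (hUm.diff hKm)
      ((hJi hUK).sub (hone hUK)) ((hJi hUnK).sub (hone hUnK))
  have hdiff : ∫ y in U, (J (fderiv ℝ (mavg δ u) y) - J (fderiv ℝ u y))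
      = (∫ y in U, (J (fderiv ℝ (mavg δ u) y) - 1)) - ∫ y in U, (J (fderiv ℝ u y) - 1) := by
    rw [integral_sub (integrableOn_J hwL (hfin hUB)) (hJi hUB),
      integral_sub (integrableOn_J hwL (hfin hUB)) (hone hUB), integral_sub (hJi hUB) (hone hUB)]
    ring
  have hA0 : 0 ≤ ∫ y in A, g y := integral_nonneg hg0
  have hUK0 : 0 ≤ ∫ y in U ∩ K, g y := integral_nonneg hg0
  have hUKI : ∫ y in U ∩ K, g y ≤ I := hmono hUK Subset.rfl
  set a := ∫ y in A, g y
  set b := ∫ y in U ∩ K, g y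
  set x := ∫ y in U \ K, g y
  set Q := θ⁻¹ * κ⁻¹ * Γ ^ 2 with hQ
  have hQ0 : 0 ≤ Q := by positivity
  have hQ1 : (1 + θ⁻¹) * (m * (κ⁻¹ * Γ ^ 2)) * volume.real U ≤ 2 * (m * vB * Q) := by
    have h1 : 1 + θ⁻¹ ≤ 2 * θ⁻¹ := by
      have := (one_le_inv₀ hθ).2 hθ1
      linarith
    calc _ ≤ (2 * θ⁻¹) * (m * (κ⁻¹ * Γ ^ 2)) * vB := by gcongr
      _ = _ := by rw [hQ]; ring
  -- The leading terms `b / 2` from `hGlow` with `hupper` and from `hlow1` cancel. The steep energy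
  -- `x` survives only on the side of `u`, with the coefficient `(2 + T)⁻¹`.
  have hmain : (2 + T)⁻¹ * x ≤ θ * I + κ * I + Γ * I + (1 + P) * a + m * vB * Q := by
    have e1 : θ * b ≤ θ * I := by gcongr
    have e2 : κ * b ≤ κ * I := by gcongr
    have e3 : Γ * (∫ y in U, G y) ≤ Γ * I := by gcongr
    have e4 : (1 + θ) * (∫ y in S' ∩ K, g y) ≤ (1 + θ) * (b + a) := by gcongr
    have e5 : θ * a ≤ 1 * a := by gcongr
    have e6 : 0 ≤ θ * I := by positivity
    have e7 : 0 ≤ κ * b := by positivity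
    linarith
  have hfinal : θ * I + κ * I + Γ * I + (1 + P) * a + m * vB * Q
      ≤ (1 + P + m * vB + 1) * ((θ + κ + Γ) * I + a + Q) := by
    have e1 : 0 ≤ (θ + κ + Γ) * I := by positivity
    have e2 : 0 ≤ m * vB := by positivity
    have e3 : 0 ≤ (P + m * vB + 1) * ((θ + κ + Γ) * I) := by positivity
    have e4 : 0 ≤ (m * vB + 1) * a := by positivity
    have e5 : 0 ≤ (1 + P + 1) * Q := by positivity
    linarith
  have hfin2 := hmain.trans hfinal
  rw [inv_mul_le_iff₀ (by positivity)] at hfin2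
  rw [mul_assoc]
  exact hfin2

end Competitor

/-! ### Choice of scales and Lipschitz approximation on the unit ball -/

section LipschitzApproximation

variable {m n : ℕ} {u : E m → E n} {C : ℝ≥0}

theorem setIntegral_hs_le_excess (hu : LipschitzWith C u) {S : Set (E m)} (hS : volume S ≠ ∞) :
    ∫ y in S, hs (fderiv ℝ u y)
      ≤ (2 + m * (C : ℝ) ^ 2) * ∫ y in S, (J (fderiv ℝ u y) - 1) := by
  rw [← integral_const_mul]
  refine integral_mono (integrableOn_hs hu hS)
    (((integrableOn_J hu hS).sub (integrableOn_const hS)).const_mul _) fun y => ?_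
  have h := J_sub_one_lower_of_hs_le (hs_fderiv_le hu y)
  rwa [div_le_iff₀' (by positivity)] at h

/-- Among `N` disjoint annuli there is one carrying at most the fraction `1 / N` of an integral. -/
theorem exists_annulus_setIntegral_le {g : E m → ℝ} (hg0 : ∀ y, 0 ≤ g y)
    (hg : IntegrableOn g (ball 0 1)) {b w : ℝ} (hw : 0 < w) {N : ℕ} (hN : 0 < N)
    (hb : b + N * w ≤ 1) :
    ∃ j < N, N * ∫ y in ball (0 : E m) (b + (j + 1) * w) \ ball (0 : E m) (b + j * w), g y
      ≤ ∫ y in ball (0 : E m) 1, g y := by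
  set A : ℕ → Set (E m) := fun j => ball (0 : E m) (b + (j + 1) * w) \ ball (0 : E m) (b + j * w)
    with hA
  have hAm : ∀ j, MeasurableSet (A j) := fun j => measurableSet_ball.diff measurableSet_ball
  have hlt : ∀ i j, i < j → Disjoint (A i) (A j) := fun i j hij => by
    refine disjoint_left.2 fun y hi hj => hj.2 (ball_subset_ball ?_ hi.1)
    have : (i : ℝ) + 1 ≤ j := by exact_mod_cast hij
    nlinarith
  have hsub : ∀ j ∈ Finset.range N, A j ⊆ ball (0 : E m) 1 := fun j hj => by
    refine sdiff_subset.trans (ball_subset_ball (le_trans ?_ hb))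
    have : (j : ℝ) + 1 ≤ N := by exact_mod_cast Finset.mem_range.1 hj
    nlinarith
  have hsum : ∑ j ∈ Finset.range N, ∫ y in A j, g y ≤ ∫ y in ball (0 : E m) 1, g y := by
    rw [← integral_biUnion_finset _ (fun j _ => hAm j) (fun i _ j _ hij => by
      rcases lt_or_gt_of_ne hij with h | h
      · exact hlt i j h
      · exact (hlt j i h).symm) fun j hj => hg.mono_set (hsub j hj)]
    exact setIntegral_mono_set hg (Filter.Eventually.of_forall hg0)
      (Filter.Eventually.of_forall (iUnion₂_subset hsub))
  obtain ⟨j, hj, hle⟩ := Finset.exists_le_of_sum_le (f := fun j => ∫ y in A j, g y)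
    (g := fun _ => (∫ y in ball (0 : E m) 1, g y) / N) (Finset.nonempty_range_iff.2 hN.ne')
    (by
      rw [Finset.sum_const, Finset.card_range, nsmul_eq_mul,
        mul_div_cancel₀ _ (by exact_mod_cast hN.ne')]
      exact hsum)
  refine ⟨j, Finset.mem_range.1 hj, ?_⟩
  rwa [le_div_iff₀' (by exact_mod_cast hN)] at hle

/-- For area minimizing maps on the unit ball with excess at most `q ^ (32 * (m + 1))`, the energy
carried by the points of large gradient is smaller than the excess by a factor `q ^ 8`. -/
theorem exists_scale_energy_lowSet_compl_le (m n : ℕ) (C : ℝ≥0) :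
    ∃ C₃ > (0 : ℝ), ∃ q₀ > (0 : ℝ), ∀ u : E m → E n, LipschitzWith C u → MinimizesArea u 0 1 →
      ∀ q : ℝ, 0 < q → q < q₀ →
      ∫ y in ball (0 : E m) 1, (J (fderiv ℝ u y) - 1) ≤ q ^ (32 * (m + 1)) →
      ∃ δ s : ℝ, 0 < δ ∧ δ ≤ q / 6 ∧ 1 - 3 * q / 4 ≤ s ∧ s ≤ 1 ∧
        (∫ y in ball (0 : E m) 1, hs (fderiv ℝ u y)) / volume.real (ball (0 : E m) δ) ≤ q ^ 31 ∧
        ∫ y in ball (0 : E m) s \ lowSet u (q ^ 8), hs (fderiv ℝ u y)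
          ≤ C₃ * q ^ (32 * (m + 1) + 8) := by
  obtain ⟨M, hM, henergy⟩ := exists_energy_lowSet_compl_le m n C
  set T : ℝ := 2 + m * (C : ℝ) ^ 2 with hT
  have hT0 : 0 < T := by positivity
  set ω : ℝ := volume.real (ball (0 : E m) 1) with hω
  have hω0 : 0 < ω := volumeReal_ball_pos one_pos
  set C₂ : ℝ := T * 12 ^ m / ω with hC₂
  have hC₂0 : 0 < C₂ := by positivity
  set C₃ : ℝ := M * ((2 + C₂) * T + T + C₂ ^ 2) with hC₃
  have hC₃0 : 0 < C₃ := by positivity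
  set R : ℝ := 2 + C₂ with hR
  have hR0 : 0 < R := by positivity
  refine ⟨C₃, hC₃0, R⁻¹, inv_pos.2 hR0, ?_⟩
  intro u hu hmin q hq hqR he
  have hqR1 : q * R < 1 := by
    have := mul_lt_mul_of_pos_right hqR hR0
    rwa [inv_mul_cancel₀ hR0.ne'] at this
  have p1 : 0 < q * C₂ := by positivity
  have hexp : q * R = q * 2 + q * C₂ := by rw [hR]; ring
  have hq1 : q < 1 := by linarith
  have hqC₂ : q * C₂ ≤ 1 := by linarith
  have hpow : ∀ {a b : ℕ}, a ≤ b → q ^ b ≤ q ^ a := fun h => pow_le_pow_of_le_one hq.le hq1.le h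
  set g : E m → ℝ := fun y => hs (fderiv ℝ u y) with hg
  have hg0 : ∀ y, 0 ≤ g y := fun _ => hs_nonneg _
  have hgi : IntegrableOn g (ball 0 1) := integrableOn_hs hu measure_ball_lt_top.ne
  set I := ∫ y in ball (0 : E m) 1, g y with hI
  have hI0 : 0 ≤ I := integral_nonneg hg0
  have hIq : I ≤ T * q ^ (32 * (m + 1)) :=
    (setIntegral_hs_le_excess hu measure_ball_lt_top.ne).trans (by gcongr)
  -- the scales
  set N : ℕ := ⌈(q ^ 11)⁻¹⌉₊ with hN
  have hq11 : 0 < (q ^ 11)⁻¹ := by positivity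
  have hN1 : (q ^ 11)⁻¹ ≤ N := Nat.le_ceil _
  have hN2 : (N : ℝ) ≤ 2 * (q ^ 11)⁻¹ := by
    have h1 := (Nat.ceil_lt_add_one hq11.le).le
    have h2 : 1 ≤ (q ^ 11)⁻¹ := (one_le_inv₀ (by positivity)).2 (pow_le_one₀ hq.le hq1.le)
    linarith
  have hNpos : 0 < N := Nat.ceil_pos.2 hq11
  have hNr : (0 : ℝ) < N := by exact_mod_cast hNpos
  -- `N` annuli of width `3 * δ` exactly fill the radii from `1 - 3 * q / 4` to `1 - q / 4`. Since
  -- `N` is about `q ^ (-11)`, `δ` is comparable to `q ^ 12`.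
  set δ : ℝ := q / (6 * N) with hδdef
  have hδ : 0 < δ := by positivity
  have hNδ : N * (3 * δ) = q / 2 := by rw [hδdef]; field_simp; norm_num
  have hδq : δ ≤ q / 6 := by
    have : (1 : ℝ) ≤ N := by exact_mod_cast hNpos
    rw [hδdef]
    gcongr
    linarith
  have hδlow : q ^ 12 / 12 ≤ δ := by
    rw [hδdef, le_div_iff₀ (by positivity)]
    calc q ^ 12 / 12 * (6 * N) ≤ q ^ 12 / 12 * (6 * (2 * (q ^ 11)⁻¹)) := by gcongr
      _ = q := by field_simp; norm_num
  obtain ⟨j, hj, hjle⟩ := exists_annulus_setIntegral_le hg0 hgi (b := 1 - 3 * q / 4) (w := 3 * δ)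
    (by positivity) hNpos (by rw [hNδ]; linarith)
  -- The chosen annulus runs from `s - δ` to `s + 2 * δ`, as the energy inequality requires; hence
  -- the shift by `δ`.
  set s : ℝ := 1 - 3 * q / 4 + j * (3 * δ) + δ with hs_def
  have hs_low : 1 - 3 * q / 4 ≤ s := by
    have : (0 : ℝ) ≤ j * (3 * δ) := by positivity
    linarith
  have hs_up : s + 2 * δ ≤ 1 := by
    have h1 : (j : ℝ) + 1 ≤ N := by exact_mod_cast hj
    have h2 : ((j : ℝ) + 1) * (3 * δ) ≤ N * (3 * δ) := by gcongr
    rw [hNδ] at h2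
    rw [hs_def]; nlinarith
  have ea : s + 2 * δ = 1 - 3 * q / 4 + (j + 1) * (3 * δ) := by rw [hs_def]; ring
  have eb : s - δ = 1 - 3 * q / 4 + j * (3 * δ) := by rw [hs_def]; ring
  rw [← ea, ← eb] at hjle
  set a := ∫ y in ball (0 : E m) (s + 2 * δ) \ ball (0 : E m) (s - δ), g y with ha
  have ha0 : 0 ≤ a := integral_nonneg hg0
  have haI : a ≤ q ^ 11 * I := by
    have h1 : (q ^ 11)⁻¹ * a ≤ I := (mul_le_mul_of_nonneg_right hN1 ha0).trans hjle
    rwa [inv_mul_le_iff₀ (by positivity)] at h1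
  -- the average excess at scale `δ`
  set Γ : ℝ := I / volume.real (ball (0 : E m) δ) with hΓ
  have hvol : volume.real (ball (0 : E m) δ) = δ ^ m * ω := by
    have := volume_ball_mul (m := m) hδ 1
    rw [mul_one] at this
    rw [Measure.real, this, ENNReal.toReal_mul, ENNReal.toReal_ofReal (by positivity), hω,
      Measure.real]
  have hΓ0 : 0 ≤ Γ := div_nonneg hI0 measureReal_nonneg
  -- Dividing the energy by the volume of a `δ`-ball costs `q ^ (12 * m)`, out of `q ^ (32 * (m +
  -- 1))`.
  have hΓq : Γ ≤ C₂ * q ^ (20 * m + 32) := by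
    rw [hΓ, hvol, div_le_iff₀ (by positivity)]
    have h1 : (q ^ 12 / 12) ^ m ≤ δ ^ m := by gcongr
    calc I ≤ T * q ^ (32 * (m + 1)) := hIq
      _ = C₂ * q ^ (20 * m + 32) * ((q ^ 12 / 12) ^ m * ω) := by
        rw [hC₂, div_pow, ← pow_mul,
          show 32 * (m + 1) = (20 * m + 32) + 12 * m by ring, pow_add]
        field_simp
      _ ≤ _ := by gcongr
  have hΓ31 : Γ ≤ q ^ 31 := by
    calc Γ ≤ C₂ * q ^ (20 * m + 32) := hΓq
      _ ≤ C₂ * q ^ 32 := mul_le_mul_of_nonneg_left (hpow (by omega)) hC₂0.le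
      _ = (q * C₂) * q ^ 31 := by ring
      _ ≤ 1 * q ^ 31 := by gcongr
      _ = q ^ 31 := one_mul _
  have hΓ1 : Γ ≤ 1 := hΓ31.trans (pow_le_one₀ hq.le hq1.le)
  set κ : ℝ := q ^ 8 with hκ
  have hκ0 : 0 < κ := by positivity
  have hκ1 : κ ≤ 1 := pow_le_one₀ hq.le hq1.le
  refine ⟨δ, s, hδ, hδq, hs_low, by linarith, hΓ31, ?_⟩
  -- With `θ = κ = q ^ 8` every error gains at least `q ^ 8` over the excess bound: the annulus
  -- gains `q ^ 11`, and the quadratic term has order `q ^ (40 * m + 48)`, against the required `q ^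
  -- (32 * m + 40)`.
  have h1 := henergy u hu hmin s δ κ κ Γ hδ hs_up hκ0 hκ1 hκ0 hκ1 hΓ hΓ1
  refine h1.trans ?_
  rw [hC₃, mul_assoc M]
  refine mul_le_mul_of_nonneg_left ?_ hM.le
  have h2 : (κ + κ + Γ) * I ≤ (2 + C₂) * T * q ^ (32 * (m + 1) + 8) := by
    have h3 : Γ ≤ C₂ * κ := hΓq.trans
      (mul_le_mul_of_nonneg_left (hpow (by omega)) hC₂0.le)
    calc (κ + κ + Γ) * I ≤ (κ + κ + C₂ * κ) * (T * q ^ (32 * (m + 1))) := by gcongr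
      _ = _ := by rw [hκ, pow_add]; ring
  have h4 : a ≤ T * q ^ (32 * (m + 1) + 8) := by
    calc a ≤ q ^ 11 * (T * q ^ (32 * (m + 1))) := haI.trans (by gcongr)
      _ ≤ q ^ 8 * (T * q ^ (32 * (m + 1))) := 
          mul_le_mul_of_nonneg_right (hpow (by norm_num)) (by positivity)
      _ = _ := by rw [pow_add]; ring
  have h5 : κ⁻¹ * κ⁻¹ * Γ ^ 2 ≤ C₂ ^ 2 * q ^ (32 * (m + 1) + 8) := by
    calc κ⁻¹ * κ⁻¹ * Γ ^ 2 ≤ κ⁻¹ * κ⁻¹ * (C₂ * q ^ (20 * m + 32)) ^ 2 := by gcongr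
      _ = C₂ ^ 2 * q ^ (40 * m + 48) := by
        rw [mul_pow, ← pow_mul, show (20 * m + 32) * 2 = (40 * m + 48) + 8 + 8 by ring, pow_add,
          pow_add, hκ]
        field_simp
      _ ≤ _ := mul_le_mul_of_nonneg_left (hpow (by omega)) (sq_nonneg C₂)
  calc _ ≤ (2 + C₂) * T * q ^ (32 * (m + 1) + 8) + T * q ^ (32 * (m + 1) + 8)
        + C₂ ^ 2 * q ^ (32 * (m + 1) + 8) := by gcongr
    _ = _ := by ring
/-- The Lipschitz approximation for area minimizing maps on the unit ball, in terms of a root `q`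
of the excess. -/
theorem exists_lipschitz_approximation (m n : ℕ) (C : ℝ≥0) :
    ∃ q₀ > (0 : ℝ), ∀ u : E m → E n, LipschitzWith C u → MinimizesArea u 0 1 →
      ∀ q : ℝ, 0 < q → q < q₀ →
      ∫ y in ball (0 : E m) 1, (J (fderiv ℝ u y) - 1) ≤ q ^ (32 * (m + 1)) →
      ∃ K : Set (E m), MeasurableSet K ∧ K ⊆ ball 0 (1 - q) ∧
        volume (ball (0 : E m) (1 - q) \ K) ≤ ENNReal.ofReal (q ^ (32 * (m + 1) + 1)) ∧
        ∀ y ∈ K, ∀ z ∈ K, ‖u y - u z‖ ≤ q * ‖y - z‖ := by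
  obtain ⟨C₃, hC₃0, q₁, hq₁, henergy⟩ := exists_scale_energy_lowSet_compl_le m n C
  -- The condition `q * R < 1` lets one spare factor `q` absorb each constant met below.
  set R : ℝ := 2 + 4 ^ m * C₃ + (2 ^ (m + 2) + 1) with hR
  have hR0 : 0 < R := by positivity
  refine ⟨min q₁ R⁻¹, lt_min hq₁ (inv_pos.2 hR0), ?_⟩
  intro u hu hmin q hq hqlt he
  have hqR1 : q * R < 1 := by
    have := mul_lt_mul_of_pos_right (hqlt.trans_le (min_le_right _ _)) hR0
    rwa [inv_mul_cancel₀ hR0.ne'] at this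
  have p2 : 0 < q * (4 ^ m * C₃) := by positivity
  have p3 : 0 < q * (2 ^ (m + 2) + 1) := by positivity
  have hexp : q * R = q * 2 + q * (4 ^ m * C₃) + q * (2 ^ (m + 2) + 1) := by rw [hR]; ring
  have hq1 : q < 1 := by linarith
  have hqC₃ : q * (4 ^ m * C₃) ≤ 1 := by linarith
  have hqL : q * (2 ^ (m + 2) + 1) ≤ 1 := by linarith
  have hpow : ∀ {a b : ℕ}, a ≤ b → q ^ b ≤ q ^ a := fun h => pow_le_pow_of_le_one hq.le hq1.le h
  obtain ⟨δ, s, hδ, hδq, hs_low, hs_up, hΓ31, hxq⟩ :=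
    henergy u hu hmin q hq (hqlt.trans_le (min_le_left _ _)) he
  set g : E m → ℝ := fun y => hs (fderiv ℝ u y) with hg
  have hg0 : ∀ y, 0 ≤ g y := fun _ => hs_nonneg _
  have hgi : IntegrableOn g (ball 0 1) := integrableOn_hs hu measure_ball_lt_top.ne
  have hκ0 : 0 < q ^ 8 := by positivity
  set U : Set (E m) := ball 0 s with hU
  set Kl := lowSet u (q ^ 8) with hKl
  have hKlm : MeasurableSet Kl := measurableSet_lowSet u _
  have hUB : U ⊆ ball 0 1 := ball_subset_ball hs_up
  set x := ∫ y in U \ Kl, g y with hx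
  -- the maximal function of the part with large gradient
  set S : Set (E m) := ball 0 (1 - q) with hS
  have hSU : ∀ y ∈ S, ball y δ ⊆ U := fun y hy => ball_subset_ball' (by
    rw [dist_zero_right]; have := mem_ball_zero_iff.1 hy; linarith)
  have hSB : ∀ y ∈ S, ball y δ ⊆ ball 0 1 := fun y hy => (hSU y hy).trans hUB
  have hDm : Measurable fun y => ‖fderiv ℝ u y‖ₑ := (measurable_fderiv ℝ u).enorm
  -- Only the steep part needs the maximal function, at level `q ^ 2`; elsewhere the gradient is at
  -- most `q ^ 4`.
  obtain ⟨Nb, hNbm, hNbv, hNb⟩ := exists_measurableSet_maximal_le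
    (f := Klᶜ.indicator fun y => ‖fderiv ℝ u y‖ₑ) hSU (ENNReal.ofReal (q ^ 2))
  refine ⟨S \ Nb, measurableSet_ball.diff hNbm, sdiff_subset, ?_, ?_⟩
  · have h1 : ∫⁻ y in U, Klᶜ.indicator (fun y => ‖fderiv ℝ u y‖ₑ) y
        ≤ ENNReal.ofReal ((q ^ 4)⁻¹ * x) := by
      have hUK : U \ Kl ⊆ ball 0 1 := sdiff_subset.trans hUB
      rw [lintegral_indicator hKlm.compl, Measure.restrict_restrict hKlm.compl, inter_comm,
        ← Set.sdiff_eq, hx, ← integral_const_mul, ofReal_integral_eq_lintegral_ofReal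
          ((hgi.mono_set hUK).const_mul _)
          (Filter.Eventually.of_forall fun y => mul_nonneg (by positivity) (hg0 y))]
      refine setLIntegral_mono' (measurableSet_ball.diff hKlm) fun y hy => ?_
      rw [← ofReal_norm]
      refine ENNReal.ofReal_le_ofReal ((norm_le_of_notMem_lowSet hκ0 hy.2).trans_eq ?_)
      rw [show q ^ 8 = (q ^ 4) ^ 2 by ring, Real.sqrt_sq (by positivity)]
    have h2 : ENNReal.ofReal (q ^ 2) * volume Nb
        ≤ ENNReal.ofReal (q ^ 2) * ENNReal.ofReal (q ^ (32 * (m + 1) + 1)) := by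
      refine hNbv.trans ((mul_le_mul_right h1 _).trans ?_)
      have h4 : (4 : ℝ≥0∞) ^ m = ENNReal.ofReal (4 ^ m) := by
        rw [ENNReal.ofReal_pow (by norm_num)]; simp
      rw [h4, ← ENNReal.ofReal_mul (by positivity), ← ENNReal.ofReal_mul (by positivity)]
      refine ENNReal.ofReal_le_ofReal ?_
      -- Of the gain `q ^ 8`, the steepness threshold uses `q ^ 4`, the level `q ^ 2` and the
      -- conclusion `q`; the last factor `q` pays for `4 ^ m * C₃`.
      calc (4 : ℝ) ^ m * ((q ^ 4)⁻¹ * x)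
          ≤ 4 ^ m * ((q ^ 4)⁻¹ * (C₃ * q ^ (32 * (m + 1) + 8))) := by gcongr
        _ = (q * (4 ^ m * C₃)) * (q ^ 2 * q ^ (32 * (m + 1) + 1)) := by
          rw [pow_add _ _ 8, pow_add _ _ 1]; field_simp; ring
        _ ≤ 1 * (q ^ 2 * q ^ (32 * (m + 1) + 1)) := by gcongr
        _ = _ := one_mul _
    refine (measure_mono ?_).trans
      ((ENNReal.mul_le_mul_iff_right (ENNReal.ofReal_pos.2 (by positivity)).ne' ENNReal.ofReal_ne_top).1 h2)
    rw [Set.sdiff_sdiff_right_self]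
    exact inter_subset_right
  · have hmax : ∀ y ∈ S \ Nb, ∀ t, 0 < t → t ≤ δ → ∫⁻ z in ball y t, ‖fderiv ℝ u z‖ₑ
        ≤ ENNReal.ofReal (2 * q ^ 2) * volume (ball (0 : E m) t) := by
      intro y hy t ht htδ
      have h1 := hNb y hy t ht htδ
      have h2 : ∫⁻ z in ball y t, Kl.indicator (fun y => ‖fderiv ℝ u y‖ₑ) z
          ≤ ENNReal.ofReal (q ^ 2) * volume (ball (0 : E m) t) := by
        rw [← Measure.addHaar_ball_center volume y, ← setLIntegral_const]
        refine lintegral_mono fun z => ?_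
        by_cases hz : z ∈ Kl
        swap
        · rw [indicator_of_notMem hz]; exact zero_le
        rw [indicator_of_mem hz, ← ofReal_norm]
        refine ENNReal.ofReal_le_ofReal ((norm_le_sqrt_hs _).trans ?_)
        rw [Real.sqrt_le_left (by positivity)]
        refine (show hs (fderiv ℝ u z) ≤ q ^ 8 from hz).trans ?_
        rw [← pow_mul]
        exact hpow (by norm_num)
      calc ∫⁻ z in ball y t, ‖fderiv ℝ u z‖ₑ
          = ∫⁻ z in ball y t, (Kl.indicator (fun y => ‖fderiv ℝ u y‖ₑ) z
            + Klᶜ.indicator (fun y => ‖fderiv ℝ u y‖ₑ) z) :=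
            lintegral_congr fun z =>
              (congrFun (indicator_self_add_compl Kl fun y => ‖fderiv ℝ u y‖ₑ) z).symm
        _ = _ := lintegral_add_left (hDm.indicator hKlm) _
        _ ≤ _ := add_le_add h2 h1
        _ = _ := by
          rw [← add_mul, ← ENNReal.ofReal_add (by positivity) (by positivity), two_mul]
    have hΛ : ∀ y ∈ S, ‖∫ h, fderiv ℝ u (y + h) ∂unif m δ‖ ≤ q ^ 2 := fun y hy => by
      rw [← fderiv_mavg hu hδ]
      refine (norm_le_sqrt_hs _).trans ?_
      rw [Real.sqrt_le_left (by positivity), ← pow_mul]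
      exact ((hs_fderiv_mavg_le hu hδ measure_ball_lt_top.ne (hSB y hy)).trans hΓ31).trans
        (hpow (by norm_num))
    have hlip := norm_sub_le_of_maximal_le_of_fderiv_mavg_le hu hδ (by positivity)
      (by positivity) (convex_ball (0 : E m) (1 - q)) sdiff_subset hmax hΛ
    intro y hy z hz
    refine (hlip y hy z hz).trans ?_
    gcongr
    calc (2 : ℝ) ^ (m + 1) * (2 * q ^ 2) + q ^ 2 = q * (2 ^ (m + 2) + 1) * q := by ring
      _ ≤ 1 * q := by gcongr
      _ = q := one_mul q

/-- The limiting case `q = 0`: the gradient vanishes almost everywhere, and the two-scale estimate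
applies with `l = Λ = 0`. Half the distance from the farther of the two points to the unit sphere is
a suitable `δ`. -/
theorem eq_of_excess_eq_zero (hu : LipschitzWith C u)
    (h0 : ∫ y in ball (0 : E m) 1, (J (fderiv ℝ u y) - 1) = 0) {y z : E m}
    (hy : y ∈ ball (0 : E m) 1) (hz : z ∈ ball (0 : E m) 1) : u y = u z := by
  have hfin : volume (ball (0 : E m) 1) ≠ ∞ := measure_ball_lt_top.ne
  have hI : ∫ y in ball (0 : E m) 1, hs (fderiv ℝ u y) = 0 :=
    le_antisymm ((setIntegral_hs_le_excess hu hfin).trans_eq (by rw [h0, mul_zero]))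
      (integral_nonneg fun _ => hs_nonneg _)
  have hae := (setIntegral_eq_zero_iff_of_nonneg_ae
    (Filter.Eventually.of_forall fun y => hs_nonneg (fderiv ℝ u y)) (integrableOn_hs hu hfin)).1 hI
  rw [mem_ball_zero_iff] at hy hz
  set δ : ℝ := (1 - max ‖y‖ ‖z‖) / 2 with hδdef
  have hmax : max ‖y‖ ‖z‖ < 1 := max_lt hy hz
  have hδ : 0 < δ := by rw [hδdef]; linarith
  have hsub : ∀ x ∈ ball (0 : E m) (1 - δ), ball x δ ⊆ ball (0 : E m) 1 := fun x hx =>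
    ball_subset_ball' (by rw [dist_zero_right]; have := mem_ball_zero_iff.1 hx; linarith)
  have h := norm_sub_le_of_maximal_le_of_fderiv_mavg_le hu hδ le_rfl le_rfl
    (convex_ball (0 : E m) (1 - δ)) Subset.rfl (fun x hx t _ htδ => by
      rw [ENNReal.ofReal_zero, zero_mul, nonpos_iff_eq_zero, lintegral_eq_zero_iff
        (measurable_fderiv ℝ u).enorm]
      filter_upwards [ae_restrict_of_ae_restrict_of_subset
        ((ball_subset_ball htδ).trans (hsub x hx)) hae] with w hw
      have h1 := norm_sq_le_hs (fderiv ℝ u w)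
      have h2 : hs (fderiv ℝ u w) = 0 := hw
      rw [h2] at h1
      have h3 : fderiv ℝ u w = 0 := by simpa using h1
      have h4 : ‖fderiv ℝ u w‖ₑ = 0 := by
        rw [← ofReal_norm, h3, norm_zero, ENNReal.ofReal_zero]
      exact h4) (fun x hx => by
      rw [← fderiv_mavg hu hδ]
      refine (norm_le_sqrt_hs _).trans ?_
      have h1 := hs_fderiv_mavg_le hu hδ hfin (hsub x hx)
      rw [hI, zero_div] at h1
      rw [Real.sqrt_eq_zero_of_nonpos h1])
    y (mem_ball_zero_iff.2 (by rw [hδdef]; linarith [le_max_left ‖y‖ ‖z‖]))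
    z (mem_ball_zero_iff.2 (by rw [hδdef]; linarith [le_max_right ‖y‖ ‖z‖]))
  simpa [sub_eq_zero] using h

end LipschitzApproximation

/-! ### Scaling back to a general ball -/

section Conclusion

variable {m n : ℕ}

/-- The map `y ↦ x + r y` scales volumes by `r ^ m`. -/
theorem volume_preimage_rescale (x : E m) {r : ℝ} (hr : 0 < r) (S : Set (E m)) :
    volume ((fun y => r⁻¹ • (y - x)) ⁻¹' S) = ENNReal.ofReal (r ^ m) * volume S := by
  have h1 : (fun y => r⁻¹ • (y - x)) ⁻¹' S = (fun y => y + -x) ⁻¹' ((r⁻¹ • ·) ⁻¹' S) := by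
    ext y; simp [sub_eq_add_neg]
  rw [h1, measure_preimage_add_right, Measure.addHaar_preimage_smul volume (inv_ne_zero hr.ne'),
    finrank_euclideanSpace_fin, inv_pow, inv_inv, abs_of_pos (by positivity)]

theorem exists_lipschitz_approximation_of_isAreaMinimizing (m n : ℕ) :
    ∃ ε > (0 : ℝ), ∃ γ > (0 : ℝ), ∀ c₀ > (0 : ℝ), ∀ (x : E m) (r : ℝ), 0 < r →
      ∀ v : E m → E n, LipschitzOnWith 2 v (ball x r) → IsAreaMinimizing c₀ v (ball x r) →
        normExcess v x r < ε →
        ∃ K : Set (E m), MeasurableSet K ∧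
          K ⊆ ball x (r * (1 - normExcess v x r ^ γ)) ∧
          volume (ball x (r * (1 - normExcess v x r ^ γ)) \ K) ≤
            ENNReal.ofReal (r ^ m * normExcess v x r ^ (1 + γ)) ∧
          ∀ y ∈ K, ∀ z ∈ K, ‖v y - v z‖ ≤ normExcess v x r ^ γ * ‖y - z‖ := by
  obtain ⟨q₀, hq₀, happrox⟩ := exists_lipschitz_approximation m n
    (lipschitzExtensionConstant (E n) * 2)
  set M : ℕ := 32 * (m + 1) with hM
  have hM0 : (M : ℝ) ≠ 0 := by rw [hM]; positivity
  have hMpos : (0 : ℝ) < M := by rw [hM]; positivity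
  -- With `γ = 1 / M` the number `q` is the excess to the power `γ`, and the excess is below `q₀ ^
  -- M` exactly when `q < q₀`.
  refine ⟨q₀ ^ M, by positivity, (M : ℝ)⁻¹, by positivity, ?_⟩
  intro c₀ hc₀ x r hr v hv hmin he
  -- A global extension of `v` makes averages and derivatives available everywhere; its Lipschitz
  -- constant depends only on `n`.
  obtain ⟨u, hu, hvu⟩ := hv.extend_finite_dimension
  set e := normExcess v x r with hedef
  set ũ := rescale u x r with hũ
  have hũL : LipschitzWith (lipschitzExtensionConstant (E n) * 2) ũ :=
    lipschitzOnWith_univ.1 (LipschitzOnWith.rescale hr (lipschitzOnWith_univ.2 hu)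
      fun _ _ => mem_univ _)
  have hũmin : MinimizesArea ũ 0 1 := (hmin.minimizesArea hc₀ hu hvu).rescale hr
  have heq : e = ∫ y in ball (0 : E m) 1, (J (fderiv ℝ ũ y) - 1) := by
    rw [hedef, normExcess_eq hu hvu, setIntegral_ball_eq x hr, ← mul_assoc,
      inv_mul_cancel₀ (by positivity), one_mul]
    simp_rw [hũ, fderiv_rescale u x hr]
  have he0 : 0 ≤ e := by
    rw [heq]; exact integral_nonneg fun y => sub_nonneg.2 (one_le_J _)
  have hsub : ball x (r * (1 - e ^ (M : ℝ)⁻¹)) ⊆ ball x r := by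
    refine ball_subset_ball ?_
    have := Real.rpow_nonneg he0 (M : ℝ)⁻¹
    nlinarith
  have hmem : ∀ {y : E m} {t : ℝ}, r⁻¹ • (y - x) ∈ ball (0 : E m) t ↔ y ∈ ball x (r * t) := by
    intro y t
    rw [← add_smul_mem_ball hr, smul_smul, mul_inv_cancel₀ hr.ne', one_smul, add_sub_cancel]
  have hback : ∀ y : E m, ũ (r⁻¹ • (y - x)) = r⁻¹ • u y := fun y => by
    rw [hũ, rescale, smul_smul, mul_inv_cancel₀ hr.ne', one_smul, add_sub_cancel]
  rcases he0.eq_or_lt with h0 | hpos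
  · have hz : e ^ (M : ℝ)⁻¹ = 0 := by rw [← h0, Real.zero_rpow (inv_ne_zero hM0)]
    rw [hz, sub_zero, mul_one]
    refine ⟨ball x r, measurableSet_ball, Subset.rfl, by simp, fun y hy z hz => ?_⟩
    have hb : ∀ w ∈ ball x r, r⁻¹ • (w - x) ∈ ball (0 : E m) 1 := fun w hw =>
      hmem.2 (by rwa [mul_one])
    have h := eq_of_excess_eq_zero hũL (heq.symm.trans h0.symm) (hb y hy) (hb z hz)
    rw [hback, hback] at h
    have h2 := smul_right_injective (E n) (inv_ne_zero hr.ne') h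
    rw [hvu hy, hvu hz, h2]
    simp
  · set q := e ^ (M : ℝ)⁻¹ with hq
    have hq0 : 0 < q := Real.rpow_pos_of_pos hpos _
    have hqM : q ^ M = e := Real.rpow_inv_natCast_pow he0 (by rw [hM]; omega)
    have hqlt : q < q₀ := by
      refine lt_of_pow_lt_pow_left₀ M hq₀.le ?_
      rwa [hqM]
    have hqM1 : e ^ (1 + (M : ℝ)⁻¹) = q ^ (M + 1) := by
      rw [Real.rpow_add hpos, Real.rpow_one, pow_succ, hqM]
    obtain ⟨K, hKm, hKs, hKv, hKl⟩ := happrox ũ hũL hũmin q hq0 hqlt (by rw [← heq, hqM])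
    have hcont : Continuous fun y : E m => r⁻¹ • (y - x) := by fun_prop
    refine ⟨(fun y => r⁻¹ • (y - x)) ⁻¹' K, hcont.measurable hKm, fun y hy => hmem.1 (hKs hy),
      ?_, fun y hy z hz => ?_⟩
    · have hset : ball x (r * (1 - q)) \ (fun y => r⁻¹ • (y - x)) ⁻¹' K
          = (fun y => r⁻¹ • (y - x)) ⁻¹' (ball 0 (1 - q) \ K) := by
        ext y
        exact and_congr_left fun _ => hmem.symm
      rw [hset, volume_preimage_rescale x hr, hqM1, ENNReal.ofReal_mul (by positivity)]
      exact mul_le_mul_right hKv _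
    · have h := hKl _ hy _ hz
      rw [hback, hback, ← smul_sub, ← smul_sub, norm_smul, norm_smul, mul_left_comm,
        sub_sub_sub_cancel_right] at h
      have h2 := le_of_mul_le_mul_left h (norm_pos_iff.2 (inv_ne_zero hr.ne'))
      rw [hvu (hsub (hmem.1 (hKs hy))), hvu (hsub (hmem.1 (hKs hz)))]
      exact h2

end Conclusion

end AreaMinGraph

end

theorem proposition2p4 (m n : ℕ) :
    ∃ ε > (0 : ℝ), ∃ γ > (0 : ℝ), ∀ c₀ > (0 : ℝ),
      ∀ (x : AreaMinGraph.E m) (r : ℝ), 0 < r →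
      ∀ v : AreaMinGraph.E m → AreaMinGraph.E n,
        LipschitzOnWith 2 v (Metric.ball x r) →
        AreaMinGraph.IsAreaMinimizing c₀ v (Metric.ball x r) →
        AreaMinGraph.normExcess v x r < ε →
        ∃ K : Set (AreaMinGraph.E m), MeasurableSet K ∧
          K ⊆ Metric.ball x (r * (1 - AreaMinGraph.normExcess v x r ^ γ)) ∧
          volume (Metric.ball x (r * (1 - AreaMinGraph.normExcess v x r ^ γ)) \ K) ≤
            ENNReal.ofReal (r ^ m * AreaMinGraph.normExcess v x r ^ (1 + γ)) ∧
          ∀ y ∈ K, ∀ z ∈ K,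
            ‖v y - v z‖ ≤ AreaMinGraph.normExcess v x r ^ γ * ‖y - z‖ :=
  AreaMinGraph.exists_lipschitz_approximation_of_isAreaMinimizing m n
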